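/- Let $M$ be a finitely generated group with a strictly ascending sequence of subgroups $G_0<G_1<G_2<\dots$ and elements $a_1,a_2,\dots\in M$; write $S^g=gSg^{-1}$. Suppose that for all $i\ge 1$: (P1) $a_i$ centralizes $G_{i-1}$; (P2) $M=\langle G_i,G_i^{a_i}\rangle$; (P4) for every $c\in G_i\setminus G_{i-1}$, neither $\langle G_i,G_i^{a_ica_i^{-1}}\rangle$ nor $\langle G_i,G_i^{a_i^{-1}ca_i}\rangle$ is contained in a conjugate of $G_n$ in $M$ for any $n\ge 0$. For $i\ge 1$ let $\beta_i:M\to M_i$ be an isomorphism onto a copy of $M$, let $L_i=M\ast_{G_{i-1}=\beta_i(G_{i-1})}M_i$, and let $\phi_i:L_i\to L_{i+1}$ be the homomorphism with $\phi_i(g)=g$ for $g\in M$ and $\phi_i(h)=\beta_{i+1}(a_i)\,\beta_i^{-1}(h)\,\beta_{i+1}(a_i)^{-1}$ for $h\in M_i$. Let $L$ be the direct limit of $(L_i,\phi_i)$, with natural map $\psi_1:L_1\to L$. Let $T_i$ be the geometric realization of the Bass–Serre tree of $L_i$ (vertices $gM$ and $gM_i$, edges $gG_{i-1}$ joining $gM$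 to $gM_i$, for $g\in L_i$) with the path metric $d_i$ in which every edge has length $2^{-(i-1)}$. Let $\varphi_i:T_i\to T_{i+1}$ be the map which, for every $g\in L_i$, sends the half of the edge $gG_{i-1}$ adjacent to $gM$ isometrically onto the edge $\phi_i(g)G_i$, and the half adjacent to $gM_i$ isometrically onto the edge $\phi_i(g)\beta_{i+1}(a_i)G_i$, so that the midpoint goes to the vertex $\phi_i(g)M_{i+1}$, the vertex $gM$ to $\phi_i(g)M$, and the vertex $gM_i$ to $\phi_i(g)\beta_{i+1}(a_i)M$. For $i\le j$ put $\varphi_{ij}=\varphi_{j-1}\circ\dots\circ\varphi_i$. Then: (1) For every $i$, $(T_i,d_i)$ is an $\mathbb{R}$-tree on which $L_i$ acts by isometries; $\phi_i$ and $\varphi_i$ are surjective; $\varphi_i(g\circ x)=\phi_i(g)\circ\varphi_i(x)$ for all $g\in L_i$, $x\in T_i$; and $\varphi_i$ is a morphism of $\mathbb{R}$-trees, i.e. every geodesic segment of $T_i$ can be subdivided into finitely many segments on each of which $\varphi_i$ is an isometric embedding. (2) The sequence $(T_i,d_i,\varphi_i)$ converges strongly: for all $l\ge 1$ and $x,y\in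 T_l$ there is $k\ge l$ such that $d_j(\varphi_{lj}(s),\varphi_{lj}(t))=d_k(\varphi_{lk}(s),\varphi_{lk}(t))$ for all $s,t\in[x,y]$ and all $j\ge k$. (3) Let $(T,d)$ be the limit, that is, the metric space obtained from $T_1$ with the pseudometric $\hat d(x,y)=\lim_{i\to\infty}d_i(\varphi_{1i}(x),\varphi_{1i}(y))$ by identifying points at $\hat d$-distance $0$, and let $\theta_1:T_1\to T$ be the quotient map. Then $(T,d)$ is an $\mathbb{R}$-tree. (4) There is an action of $L$ on $T$ by isometries with $\psi_1(g)\circ\theta_1(x)=\theta_1(g\circ x)$ for all $g\in L_1$, $x\in T_1$. It is non-trivial, i.e. it has no global fixed point, and for any two distinct points $\bar x,\bar y\in T$ there is $m\ge 1$ such that the pointwise stabilizer in $L$ of the geodesic segment $[\bar x,\bar y]$ is isomorphic to a subgroup of $G_{m-1}$. -/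

import Mathlib

open Filter Topology

namespace StrongLimit

noncomputable section

/-! ### Real trees -/

/-- `γ` restricted to `[0, ℓ]` is an isometric embedding. -/
def IsGeodesic {X : Type*} [MetricSpace X] (γ : ℝ → X) (ℓ : ℝ) : Prop :=
  0 ≤ ℓ ∧ ∀ s ∈ Set.Icc 0 ℓ, ∀ t ∈ Set.Icc 0 ℓ, dist (γ s) (γ t) = |s - t|

/-- `A` is a geodesic segment with endpoints `x` and `y`. -/
def IsSegment {X : Type*} [MetricSpace X] (A : Set X) (x y : X) : Prop :=
  ∃ (γ : ℝ → X) (ℓ : ℝ), IsGeodesic γ ℓ ∧ γ 0 = x ∧ γ ℓ = y ∧ A = γ '' Set.Icc 0 ℓ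

/-- A metric space is an `ℝ`-tree if it is geodesic, the intersection of two geodesic segments
with a common endpoint is a geodesic segment, and the union of two geodesic segments that share
only a single endpoint is a geodesic segment. -/
structure IsRTree (X : Type*) [MetricSpace X] : Prop where
  geodesic : ∀ x y : X, ∃ A, IsSegment A x y
  inter : ∀ (x y z : X) (A B : Set X), IsSegment A x y → IsSegment B x z →
    ∃ p q, IsSegment (A ∩ B) p q
  union : ∀ (x y z : X) (A B : Set X), IsSegment A x y → IsSegment B x z → A ∩ B = {x} →
    ∃ p q, IsSegment (A ∪ B) p q

/-- Morphisms of `ℝ`-trees: every geodesic segment can be subdivided into finitely many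
segments on each of which the map is an isometric embedding. -/
def IsTreeMorphism {X Y : Type*} [MetricSpace X] [MetricSpace Y] (f : X → Y) : Prop :=
  ∀ (γ : ℝ → X) (ℓ : ℝ), IsGeodesic γ ℓ → ∃ (n : ℕ) (t : ℕ → ℝ), Monotone t ∧ t 0 = 0 ∧ t n = ℓ ∧
    ∀ k < n, ∀ u ∈ Set.Icc (t k) (t (k + 1)), ∀ v ∈ Set.Icc (t k) (t (k + 1)),
      dist (f (γ u)) (f (γ v)) = dist (γ u) (γ v)

/-! ### Sequences of metric spaces and their strong limits -/

/-- The composition `X l → X (l + 1) → ⋯ → X j` of the maps of a sequence. -/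
def seqMap {X : ℕ → Type*} (f : ∀ n, X n → X (n + 1)) {l j : ℕ} (h : l ≤ j) (x : X l) : X j :=
  Nat.leRecOn h (fun {k} => f k) x

theorem seqMap_self {X : ℕ → Type*} (f : ∀ n, X n → X (n + 1)) {l : ℕ} (x : X l) :
    seqMap f le_rfl x = x := Nat.leRecOn_self x

theorem seqMap_succ {X : ℕ → Type*} (f : ∀ n, X n → X (n + 1)) {l j : ℕ} (h : l ≤ j) (x : X l) :
    seqMap f (Nat.le_succ_of_le h) x = f j (seqMap f h x) := Nat.leRecOn_succ h x

/-- Strong convergence of a sequence of `ℝ`-trees. -/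
def ConvergesStrongly {X : ℕ → Type*} [∀ n, MetricSpace (X n)] (f : ∀ n, X n → X (n + 1)) : Prop :=
  ∀ (l : ℕ) (x y : X l), ∃ (k : ℕ) (hk : l ≤ k), ∀ A : Set (X l), IsSegment A x y →
    ∀ s ∈ A, ∀ t ∈ A, ∀ (j : ℕ) (hj : k ≤ j),
      dist (seqMap f (hk.trans hj) s) (seqMap f (hk.trans hj) t)
        = dist (seqMap f hk s) (seqMap f hk t)

/-- The limit pseudometric on the first space of a sequence: the limit of the distances between
the images of two points. -/
def limDist {X : ℕ → Type*} [∀ n, MetricSpace (X n)] (f : ∀ n, X n → X (n + 1)) (x y : X 0) : ℝ :=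
  limUnder atTop fun n => dist (seqMap f (Nat.zero_le n) x) (seqMap f (Nat.zero_le n) y)

theorem tendsto_limDist {X : ℕ → Type*} [∀ n, MetricSpace (X n)] (f : ∀ n, X n → X (n + 1))
    (hf : ∀ n, LipschitzWith 1 (f n)) (x y : X 0) :
    Tendsto (fun n => dist (seqMap f (Nat.zero_le n) x) (seqMap f (Nat.zero_le n) y)) atTop
      (𝓝 (limDist f x y)) := by
  apply tendsto_nhds_limUnder
  refine ⟨_, tendsto_atTop_ciInf (antitone_nat_of_succ_le fun n => ?_)
    ⟨0, by rintro _ ⟨n, rfl⟩; exact dist_nonneg⟩⟩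
  have e : ∀ z : X 0, seqMap f (Nat.zero_le (n + 1)) z = f n (seqMap f (Nat.zero_le n) z) :=
    fun z => seqMap_succ f (Nat.zero_le n) z
  rw [e, e]
  simpa using (hf n).dist_le_mul (seqMap f (Nat.zero_le n) x) (seqMap f (Nat.zero_le n) y)

/-- The first space of the sequence, to be equipped with the limit pseudometric. -/
def LimitPre {X : ℕ → Type*} [∀ n, MetricSpace (X n)] (f : ∀ n, X n → X (n + 1))
    (_ : ∀ n, LipschitzWith 1 (f n)) : Type _ := X 0

instance {X : ℕ → Type*} [∀ n, MetricSpace (X n)] (f : ∀ n, X n → X (n + 1))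
    (hf : ∀ n, LipschitzWith 1 (f n)) : PseudoMetricSpace (LimitPre f hf) where
  dist x y := limDist f x y
  dist_self x := by
    refine tendsto_nhds_unique (tendsto_limDist f hf x x) ?_
    simp
  dist_comm x y := by
    refine tendsto_nhds_unique (tendsto_limDist f hf x y) ?_
    simpa only [dist_comm] using tendsto_limDist f hf y x
  dist_triangle x y z :=
    le_of_tendsto_of_tendsto' (tendsto_limDist f hf x z)
      ((tendsto_limDist f hf x y).add (tendsto_limDist f hf y z)) fun _ => dist_triangle _ _ _

/-- The limit space: the quotient of the first space by `limDist x y = 0`, with the induced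
metric. -/
abbrev LimitSpace {X : ℕ → Type*} [∀ n, MetricSpace (X n)] (f : ∀ n, X n → X (n + 1))
    (hf : ∀ n, LipschitzWith 1 (f n)) : Type _ := SeparationQuotient (LimitPre f hf)

/-- The natural map from the first space to the limit space. -/
def toLimit {X : ℕ → Type*} [∀ n, MetricSpace (X n)] (f : ∀ n, X n → X (n + 1))
    (hf : ∀ n, LipschitzWith 1 (f n)) (x : X 0) : LimitSpace f hf :=
  SeparationQuotient.mk (X := LimitPre f hf) x

/-! ### Geometric realization of a bipartite graph

The graph has edge set `E` and disjoint vertex sets `V`, `W`; the edge `e` joins `o e` to `t e`,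
and `o`, `t` are surjective in the cases used below.  The realization is obtained from
`E × [0, 1]` by gluing `(e, 0)` to `(e', 0)` when `o e = o e'`, and `(e, 1)` to `(e', 1)` when
`t e = t e'`. -/

section Realization

variable {E V W : Type*} (o : E → V) (t : E → W)

/-- The gluing relation. -/
def realizationSetoid : Setoid (E × unitInterval) where
  r p q := p.2 = q.2 ∧ (p.2 = 0 → o p.1 = o q.1) ∧ (p.2 = 1 → t p.1 = t q.1) ∧
    (p.2 ≠ 0 → p.2 ≠ 1 → p.1 = q.1)
  iseqv := by
    refine ⟨fun p => by simp, ?_, ?_⟩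
    · rintro ⟨e, s⟩ ⟨e', s'⟩ ⟨h, h0, h1, h2⟩
      dsimp only at *
      subst h
      exact ⟨rfl, fun h => (h0 h).symm, fun h => (h1 h).symm, fun h h' => (h2 h h').symm⟩
    · rintro ⟨e, s⟩ ⟨e', s'⟩ ⟨e'', s''⟩ ⟨h, h0, h1, h2⟩ ⟨h', h0', h1', h2'⟩
      dsimp only at *
      subst h h'
      exact ⟨rfl, fun h => (h0 h).trans (h0' h), fun h => (h1 h).trans (h1' h),
        fun h h' => (h2 h h').trans (h2' h h')⟩

/-- The geometric realization. -/
def Realization : Type _ := Quotient (realizationSetoid o t)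

/-- The point with coordinate `s` on the edge `e`. -/
def Realization.pt (e : E) (s : unitInterval) : Realization o t :=
  Quotient.mk (realizationSetoid o t) (e, s)

/-- `HasPath o t x y r`: there is a path of length `r` from `x` to `y` which is a concatenation of
finitely many segments, each contained in an edge, all edges having length `1`. -/
inductive HasPath : Realization o t → Realization o t → ℝ → Prop
  | nil (x : Realization o t) : HasPath x x 0
  | cons (e : E) (s u : unitInterval) (y : Realization o t) (r : ℝ) :
      HasPath (Realization.pt o t e u) y r →
        HasPath (Realization.pt o t e s) y (|(s : ℝ) - u| + r)

/-- The standard simplicial (path) metric, in which all edges have length `1`. -/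
def simplicialDist (x y : Realization o t) : ℝ := sInf {r | HasPath o t x y r}

variable {o t}

theorem HasPath.nonneg {x y : Realization o t} {r : ℝ} (h : HasPath o t x y r) : 0 ≤ r := by
  induction h with
  | nil => exact le_rfl
  | cons e s u y r _ ih => positivity

theorem HasPath.trans {x y z : Realization o t} {r r' : ℝ} (h : HasPath o t x y r)
    (h' : HasPath o t y z r') : HasPath o t x z (r + r') := by
  induction h with
  | nil => simpa using h'
  | cons e s u y r _ ih => rw [add_assoc]; exact .cons e s u z _ (ih h')

theorem HasPath.edge (e : E) (s u : unitInterval) :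
    HasPath o t (Realization.pt o t e s) (Realization.pt o t e u) |(s : ℝ) - u| := by
  simpa using HasPath.cons e s u _ 0 (.nil (Realization.pt o t e u))

theorem HasPath.symm {x y : Realization o t} {r : ℝ} (h : HasPath o t x y r) :
    HasPath o t y x r := by
  induction h with
  | nil x => exact .nil x
  | cons e s u y r _ ih =>
    rw [add_comm, abs_sub_comm]
    exact ih.trans (.edge e u s)

theorem HasPath.simplicialDist_le {x y : Realization o t} {r : ℝ} (h : HasPath o t x y r) :
    simplicialDist o t x y ≤ r :=
  csInf_le ⟨0, fun _ h => h.nonneg⟩ h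

theorem simplicialDist_nonneg (x y : Realization o t) : 0 ≤ simplicialDist o t x y :=
  Real.sInf_nonneg fun _ h => h.nonneg

theorem simplicialDist_triangle (hc : ∀ x y : Realization o t, ∃ r, HasPath o t x y r)
    (x y z : Realization o t) :
    simplicialDist o t x z ≤ simplicialDist o t x y + simplicialDist o t y z := by
  rw [← sub_le_iff_le_add]
  refine le_csInf (hc x y) fun r hr => ?_
  rw [sub_le_comm]
  refine le_csInf (hc y z) fun r' hr' => ?_
  have := (HasPath.trans hr hr').simplicialDist_le
  linarith

theorem HasPath.abs_sub_le {x y : Realization o t} {r : ℝ} (h : HasPath o t x y r)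
    (f : Realization o t → ℝ) (hf : ∀ e (s u : unitInterval),
      |f (Realization.pt o t e s) - f (Realization.pt o t e u)| ≤ |(s : ℝ) - u|) :
    |f x - f y| ≤ r := by
  induction h with
  | nil => simp
  | cons e s u y r _ ih =>
    exact (_root_.abs_sub_le _ (f (Realization.pt o t e u)) _).trans (add_le_add (hf e s u) ih)

/-- A function that is `1`-Lipschitz on edges does not separate points at distance zero. -/
theorem eq_of_simplicialDist_eq_zero' (hc : ∀ x y : Realization o t, ∃ r, HasPath o t x y r)
    {x y : Realization o t} (h : simplicialDist o t x y = 0)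
    (f : Realization o t → ℝ) (hf : ∀ e (s u : unitInterval),
      |f (Realization.pt o t e s) - f (Realization.pt o t e u)| ≤ |(s : ℝ) - u|) : f x = f y := by
  have : |f x - f y| ≤ simplicialDist o t x y :=
    le_csInf (hc x y) fun r hr => HasPath.abs_sub_le hr f hf
  rw [h] at this
  exact sub_eq_zero.1 (abs_eq_zero.1 (le_antisymm this (abs_nonneg _)))

open Classical in
theorem eq_of_simplicialDist_eq_zero (hc : ∀ x y : Realization o t, ∃ r, HasPath o t x y r)
    {x y : Realization o t} (h : simplicialDist o t x y = 0) : x = y := by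
  obtain ⟨⟨e, s⟩, rfl⟩ := Quotient.exists_rep x
  obtain ⟨⟨e', s'⟩, rfl⟩ := Quotient.exists_rep y
  have key := fun f hf => eq_of_simplicialDist_eq_zero' hc h f hf
  have hs : s = s' := by
    have := key (Quotient.lift (fun p => (p.2 : ℝ)) fun p q hpq => by
      exact congrArg Subtype.val hpq.1) fun _ _ _ => le_rfl
    exact Subtype.ext this
  subst hs
  refine Quotient.sound ⟨rfl, ?_, ?_, ?_⟩
  · rintro (rfl : s = 0)
    have := key (Quotient.lift (fun p => if o e = o p.1 then (p.2 : ℝ) else 1) ?_) ?_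
    · by_contra hne
      have h' : (if o e = o e then ((0 : unitInterval) : ℝ) else 1)
        = if o e = o e' then ((0 : unitInterval) : ℝ) else 1 := this
      rw [if_pos rfl, if_neg hne] at h'
      simp at h'
    · rintro ⟨f, s⟩ ⟨f', s'⟩ ⟨h, h0, h1, h2⟩
      dsimp only at *
      subst h
      by_cases hs0 : s = 0
      · rw [h0 hs0]
      · by_cases hs1 : s = 1
        · simp [hs1]
        · rw [h2 hs0 hs1]
    · intro f s u
      change |(if o e = o f then (s : ℝ) else 1) - if o e = o f then (u : ℝ) else 1| ≤ _
      split_ifs <;> simp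
  · rintro (rfl : s = 1)
    have := key (Quotient.lift (fun p => if t e = t p.1 then (p.2 : ℝ) else 0) ?_) ?_
    · by_contra hne
      have h' : (if t e = t e then ((1 : unitInterval) : ℝ) else 0)
        = if t e = t e' then ((1 : unitInterval) : ℝ) else 0 := this
      rw [if_pos rfl, if_neg hne] at h'
      simp at h'
    · rintro ⟨f, s⟩ ⟨f', s'⟩ ⟨h, h0, h1, h2⟩
      dsimp only at *
      subst h
      by_cases hs0 : s = 0
      · simp [hs0]
      · by_cases hs1 : s = 1
        · rw [h1 hs1]
        · rw [h2 hs0 hs1]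
    · intro f s u
      change |(if t e = t f then (s : ℝ) else 0) - if t e = t f then (u : ℝ) else 0| ≤ _
      split_ifs <;> simp
  · intro hs0 hs1
    dsimp only at *
    have := key (Quotient.lift (fun p =>
      if e = p.1 then |(p.2 : ℝ) - s| ⊓ (s ⊓ (1 - s)) else (s : ℝ) ⊓ (1 - s)) ?_) ?_
    · by_contra hne
      have h' : (if e = e then |(s : ℝ) - s| ⊓ (s ⊓ (1 - s)) else (s : ℝ) ⊓ (1 - s))
        = if e = e' then |(s : ℝ) - s| ⊓ (s ⊓ (1 - s)) else (s : ℝ) ⊓ (1 - s) := this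
      rw [if_pos rfl, if_neg hne] at h'
      have p0 : (0 : ℝ) < s := unitInterval.pos_iff_ne_zero.2 hs0
      have p1 : (s : ℝ) < 1 := unitInterval.lt_one_iff_ne_one.2 hs1
      have : (0 : ℝ) < (s : ℝ) ⊓ (1 - s) := lt_min p0 (by linarith)
      rw [sub_self, abs_zero, min_eq_left this.le] at h'
      exact this.ne h'
    · rintro ⟨f, u⟩ ⟨f', u'⟩ ⟨h, h0, h1, h2⟩
      dsimp only at *
      subst h
      have n0 := s.2.1
      have n1 := s.2.2
      by_cases hu0 : u = 0
      · subst hu0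
        have : |((0 : unitInterval) : ℝ) - s| ⊓ ((s : ℝ) ⊓ (1 - s)) = (s : ℝ) ⊓ (1 - s) := by
          refine min_eq_right ?_
          simp [abs_of_nonneg n0]
        rw [this]; simp
      · by_cases hu1 : u = 1
        · subst hu1
          have : |((1 : unitInterval) : ℝ) - s| ⊓ ((s : ℝ) ⊓ (1 - s)) = (s : ℝ) ⊓ (1 - s) := by
            refine min_eq_right ?_
            simp [abs_of_nonneg (sub_nonneg.2 n1)]
          rw [this]; simp
        · rw [h2 hu0 hu1]
    · intro f u v
      change |(if e = f then |(u : ℝ) - s| ⊓ (s ⊓ (1 - s)) else (s : ℝ) ⊓ (1 - s)) -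
        if e = f then |(v : ℝ) - s| ⊓ (s ⊓ (1 - s)) else (s : ℝ) ⊓ (1 - s)| ≤ _
      split_ifs
      · refine (abs_min_sub_min_le_max _ _ _ _).trans (max_le ?_ (by simp))
        refine (abs_abs_sub_abs_le _ _).trans (le_of_eq ?_)
        congr 1
        ring
      · simp

variable (o t) in
/-- The realization of a connected graph in which every edge has length `ℓ`. -/
abbrev Realization.metricSpace (ℓ : ℝ) (hℓ : 0 < ℓ)
    (hc : ∀ x y : Realization o t, ∃ r, HasPath o t x y r) : MetricSpace (Realization o t) where
  dist x y := ℓ * simplicialDist o t x y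
  dist_self x := by
    have := (HasPath.nil x).simplicialDist_le
    rw [le_antisymm this (simplicialDist_nonneg x x), mul_zero]
  dist_comm x y := by
    have : {r | HasPath o t x y r} = {r | HasPath o t y x r} :=
      Set.ext fun r => ⟨HasPath.symm, HasPath.symm⟩
    simp only [simplicialDist, this]
  dist_triangle x y z := by
    rw [← mul_add]
    exact mul_le_mul_of_nonneg_left (simplicialDist_triangle hc x y z) hℓ.le
  eq_of_dist_eq_zero {x y} h := by
    have h' : ℓ * simplicialDist o t x y = 0 := h
    exact eq_of_simplicialDist_eq_zero hc ((mul_eq_zero.1 h').resolve_left hℓ.ne')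

end Realization

/-! ### The Bass–Serre tree of an amalgam

Given subgroups `C ≤ A`, `C ≤ B` of `L`, the graph has vertices `L ⧸ A` and `L ⧸ B` and edges
`L ⧸ C`, the edge `g C` joining `g A` to `g B`. -/

section CosetGraph

variable {L : Type*} [Group L] {A B C : Subgroup L}

/-- The geometric realization of the coset graph. -/
abbrev CosetGraph (hA : C ≤ A) (hB : C ≤ B) : Type _ :=
  Realization (Subgroup.quotientMapOfLE hA) (Subgroup.quotientMapOfLE hB)

theorem quotientMapOfLE_smul {D : Subgroup L} (h : C ≤ D) (g : L) (e : L ⧸ C) :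
    Subgroup.quotientMapOfLE h (g • e) = g • Subgroup.quotientMapOfLE h e := by
  obtain ⟨k, rfl⟩ := QuotientGroup.mk_surjective e
  rfl

/-- `L` acts by left translation of the edges. -/
instance CosetGraph.mulAction (hA : C ≤ A) (hB : C ≤ B) : MulAction L (CosetGraph hA hB) where
  smul g := Quotient.map (fun p => (g • p.1, p.2)) (by
    rintro ⟨e, s⟩ ⟨e', s'⟩ ⟨h, h0, h1, h2⟩
    refine ⟨h, fun hs => ?_, fun hs => ?_, fun hs hs' => ?_⟩
    · simp only [quotientMapOfLE_smul]; rw [h0 hs]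
    · simp only [quotientMapOfLE_smul]; rw [h1 hs]
    · exact congrArg (g • ·) (h2 hs hs'))
  one_smul x := by
    obtain ⟨⟨e, s⟩, rfl⟩ := Quotient.exists_rep x
    exact congrArg (Quotient.mk _) (Prod.ext (one_smul L e) rfl)
  mul_smul g h x := by
    obtain ⟨⟨e, s⟩, rfl⟩ := Quotient.exists_rep x
    exact congrArg (Quotient.mk _) (Prod.ext (mul_smul g h e) rfl)

theorem CosetGraph.smul_pt (hA : C ≤ A) (hB : C ≤ B) (g : L) (e : L ⧸ C) (s : unitInterval) :
    g • (Realization.pt _ _ e s : CosetGraph hA hB) = Realization.pt _ _ (g • e) s := rfl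

theorem CosetGraph.hasPath_smul (hA : C ≤ A) (hB : C ≤ B) (g : L) {x y : CosetGraph hA hB} {r : ℝ}
    (h : HasPath _ _ x y r) : HasPath _ _ (g • x) (g • y) r := by
  induction h with
  | nil x => exact .nil _
  | cons e s u y r _ ih => exact .cons (g • e) s u _ r ih

/-- If `A` and `B` generate `L` then the coset graph is connected. -/
theorem CosetGraph.connected (hA : C ≤ A) (hB : C ≤ B) (hAB : A ⊔ B = ⊤)
    (x y : CosetGraph hA hB) : ∃ r, HasPath _ _ x y r := by
  let p : L → CosetGraph hA hB := fun g => Realization.pt _ _ (g : L ⧸ C) 0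
  have hp : ∀ g h : L, g • p h = p (g * h) := fun g h => rfl
  let S : Subgroup L :=
    { carrier := {g | ∃ r, HasPath _ _ (p 1) (p g) r}
      one_mem' := ⟨0, .nil _⟩
      mul_mem' := by
        rintro g h ⟨r, hr⟩ ⟨r', hr'⟩
        refine ⟨r + r', hr.trans ?_⟩
        simpa [hp] using CosetGraph.hasPath_smul hA hB g hr'
      inv_mem' := by
        rintro g ⟨r, hr⟩
        refine ⟨r, ?_⟩
        simpa [hp] using (CosetGraph.hasPath_smul hA hB g⁻¹ hr).symm }
  have hAS : A ≤ S := by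
    intro g hg
    have : p 1 = p g := Quotient.sound ⟨rfl, fun _ => by
      simpa [QuotientGroup.eq] using hg, fun h => absurd h (by simp), fun h => absurd rfl h⟩
    exact ⟨0, by rw [← this]; exact .nil _⟩
  have hBS : B ≤ S := by
    intro g hg
    have : (Realization.pt _ _ ((1 : L) : L ⧸ C) 1 : CosetGraph hA hB)
        = Realization.pt _ _ (g : L ⧸ C) 1 :=
      Quotient.sound ⟨rfl, fun h => absurd h (by simp), fun _ => by
        simpa [QuotientGroup.eq] using hg, fun _ h => absurd rfl h⟩
    have e1 : HasPath _ _ (p 1) _ _ := HasPath.edge ((1 : L) : L ⧸ C) 0 1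
    have e2 : HasPath _ _ _ (p g) _ := HasPath.edge (g : L ⧸ C) 1 0
    rw [this] at e1
    exact ⟨_, e1.trans e2⟩
  have hS : ∀ g, g ∈ S := fun g => (hAB ▸ sup_le hAS hBS : (⊤ : Subgroup L) ≤ S) trivial
  have base : ∀ z : CosetGraph hA hB, ∃ r, HasPath _ _ (p 1) z r := by
    intro z
    obtain ⟨⟨e, s⟩, rfl⟩ := Quotient.exists_rep z
    obtain ⟨g, rfl⟩ := QuotientGroup.mk_surjective e
    obtain ⟨r, hr⟩ := hS g
    exact ⟨_, hr.trans (.edge (g : L ⧸ C) 0 s)⟩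
  obtain ⟨r, hr⟩ := base x
  obtain ⟨r', hr'⟩ := base y
  exact ⟨_, hr.symm.trans hr'⟩

end CosetGraph

/-! ### The data `M`, `G₀ < G₁ < ⋯`, `a₁, a₂, …` -/

section Data

variable {M : Type*} [Group M]

/-- The conjugate `g H g⁻¹`. -/
def conjSubgroup (g : M) (H : Subgroup M) : Subgroup M := H.map (MulAut.conj g).toMonoidHom

/-- `a i` centralizes `G (i - 1)` for `i ≥ 1`. -/
def CondP1 (G : ℕ → Subgroup M) (a : ℕ → M) : Prop :=
  ∀ i : ℕ, ∀ g ∈ G i, a (i + 1) * g = g * a (i + 1)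

/-- `M` is generated by `G i` and its conjugate by `a i`, for `i ≥ 1`. -/
def CondP2 (G : ℕ → Subgroup M) (a : ℕ → M) : Prop :=
  ∀ i : ℕ, G (i + 1) ⊔ conjSubgroup (a (i + 1)) (G (i + 1)) = ⊤

/-- For `i ≥ 1` and `c ∈ G i \ G (i - 1)`, neither of the subgroups generated by `G i` and its
conjugate by `a i * c * (a i)⁻¹`, respectively by `(a i)⁻¹ * c * a i`, is contained in a conjugate
of some `G n`. -/
def CondP4 (G : ℕ → Subgroup M) (a : ℕ → M) : Prop :=
  ∀ i : ℕ, ∀ c ∈ G (i + 1), c ∉ G i → ∀ (n : ℕ) (g : M),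
    ¬ G (i + 1) ⊔ conjSubgroup (a (i + 1) * c * (a (i + 1))⁻¹) (G (i + 1))
        ≤ conjSubgroup g (G n) ∧
    ¬ G (i + 1) ⊔ conjSubgroup ((a (i + 1))⁻¹ * c * a (i + 1)) (G (i + 1))
        ≤ conjSubgroup g (G n)

/-- The amalgamated free product of two copies of `M` along `G n`.
With indices starting from `1` this is the group `L_{n+1}`. -/
abbrev Amalgam (G : ℕ → Subgroup M) (n : ℕ) : Type _ :=
  Monoid.PushoutI (ι := Bool) (G := fun _ => M) (fun _ => (G n).subtype)

/-- The inclusion of the first factor `M`. -/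
def inM (G : ℕ → Subgroup M) (n : ℕ) : M →* Amalgam G n :=
  Monoid.PushoutI.of (ι := Bool) (G := fun _ => M) (φ := fun _ => (G n).subtype) false

/-- The inclusion of the second factor, the copy `M_{n+1}` of `M`; that is, the isomorphism
`β_{n+1} : M → M_{n+1}` followed by the inclusion. -/
def inM' (G : ℕ → Subgroup M) (n : ℕ) : M →* Amalgam G n :=
  Monoid.PushoutI.of (ι := Bool) (G := fun _ => M) (φ := fun _ => (G n).subtype) true

theorem inM_eq_inM' (G : ℕ → Subgroup M) (n : ℕ) {g : M} (hg : g ∈ G n) :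
    inM G n g = inM' G n g :=
  (Monoid.PushoutI.of_apply_eq_base (G := fun _ => M) (fun _ : Bool => (G n).subtype) false
    ⟨g, hg⟩).trans
    (Monoid.PushoutI.of_apply_eq_base (G := fun _ => M) (fun _ : Bool => (G n).subtype) true
      ⟨g, hg⟩).symm

theorem inM'_comm {G : ℕ → Subgroup M} {a : ℕ → M} (h : CondP1 G a) (n : ℕ) {g : M}
    (hg : g ∈ G n) :
    inM' G (n + 1) (a (n + 1)) * inM' G (n + 1) g = inM' G (n + 1) g * inM' G (n + 1) (a (n + 1)) := by
  rw [← map_mul, h n g hg, map_mul]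

/-- The restrictions of `phi` below to the two factors. -/
def phiFactor (G : ℕ → Subgroup M) (a : ℕ → M) (n : ℕ) : Bool → M →* Amalgam G (n + 1)
  | false => inM G (n + 1)
  | true => (MulAut.conj (inM' G (n + 1) (a (n + 1)))).toMonoidHom.comp (inM G (n + 1))

/-- The homomorphism `φ_n`, which is the identity on `M` and sends the element `h` of the second
copy of `M` to the conjugate of `h ∈ M` by `β(a)`, `β` being the second inclusion in the target. -/
def phi (G : ℕ → Subgroup M) (a : ℕ → M) (hG : Monotone G) (h : CondP1 G a) (n : ℕ) :
    Amalgam G n →* Amalgam G (n + 1) :=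
  Monoid.PushoutI.lift
    (phiFactor G a n)
    ((inM G (n + 1)).comp (G n).subtype)
    (by
      rintro (_ | _)
      · rfl
      · ext ⟨g, hg⟩
        have hg' : g ∈ G (n + 1) := hG n.le_succ hg
        change inM' G (n + 1) (a (n + 1)) * inM G (n + 1) g * (inM' G (n + 1) (a (n + 1)))⁻¹
          = inM G (n + 1) g
        rw [inM_eq_inM' G (n + 1) hg', inM'_comm h n hg, mul_inv_cancel_right])

theorem phi_inM (G : ℕ → Subgroup M) (a : ℕ → M) (hG : Monotone G) (h : CondP1 G a) (n : ℕ)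
    (g : M) : phi G a hG h n (inM G n g) = inM G (n + 1) g :=
  Monoid.PushoutI.lift_of (G := fun _ => M) (phiFactor G a n) _ _ (i := false) g

theorem phi_inM' (G : ℕ → Subgroup M) (a : ℕ → M) (hG : Monotone G) (h : CondP1 G a) (n : ℕ)
    (g : M) : phi G a hG h n (inM' G n g)
      = inM' G (n + 1) (a (n + 1)) * inM G (n + 1) g * (inM' G (n + 1) (a (n + 1)))⁻¹ :=
  Monoid.PushoutI.lift_of (G := fun _ => M) (phiFactor G a n) _ _ (i := true) g

/-! ### The limit group -/

/-- The composition of the homomorphisms `phi`. -/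
def phiLE (G : ℕ → Subgroup M) (a : ℕ → M) (hG : Monotone G) (h : CondP1 G a) (l j : ℕ)
    (hlj : l ≤ j) : Amalgam G l →* Amalgam G j where
  toFun := seqMap (fun n => phi G a hG h n) hlj
  map_one' := by
    induction j, hlj using Nat.le_induction with
    | base => exact seqMap_self _ _
    | succ j hlj ih => rw [seqMap_succ _ hlj, ih, map_one]
  map_mul' x y := by
    induction j, hlj using Nat.le_induction with
    | base => simp only [seqMap_self]
    | succ j hlj ih => simp only [seqMap_succ _ hlj, ih, map_mul]

instance (G : ℕ → Subgroup M) (a : ℕ → M) (hG : Monotone G) (h : CondP1 G a) :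
    DirectedSystem (Amalgam G) (fun l j hlj => phiLE G a hG h l j hlj) where
  map_self _ x := seqMap_self _ x
  map_map _ _ _ hij hjk x := (Nat.leRecOn_trans hij hjk x).symm

/-- The direct limit `L` of the groups `Amalgam G n` along the homomorphisms `phi`. -/
abbrev LimitGroup (G : ℕ → Subgroup M) (a : ℕ → M) (hG : Monotone G) (h : CondP1 G a) : Type _ :=
  DirectLimit (Amalgam G) (phiLE G a hG h)

/-- The natural map from the first group of the sequence to the direct limit. -/
def psi (G : ℕ → Subgroup M) (a : ℕ → M) (hG : Monotone G) (h : CondP1 G a) (g : Amalgam G 0) :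
    LimitGroup G a hG h := Quotient.mk _ ⟨0, g⟩

/-! ### The Bass–Serre trees and the maps between them -/

/-- The amalgamated subgroup `G n` inside the amalgam. -/
def edgeGroup (G : ℕ → Subgroup M) (n : ℕ) : Subgroup (Amalgam G n) := (G n).map (inM G n)

theorem edgeGroup_le (G : ℕ → Subgroup M) (n : ℕ) : edgeGroup G n ≤ (inM G n).range :=
  Subgroup.map_le_range _ _

theorem edgeGroup_le' (G : ℕ → Subgroup M) (n : ℕ) : edgeGroup G n ≤ (inM' G n).range := by
  rintro _ ⟨g, hg, rfl⟩
  exact ⟨g, (inM_eq_inM' G n hg).symm⟩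

theorem range_sup_range (G : ℕ → Subgroup M) (n : ℕ) :
    (inM G n).range ⊔ (inM' G n).range = ⊤ := by
  rw [eq_top_iff]
  intro x _
  induction x using Monoid.PushoutI.induction_on with
  | of i g =>
    cases i
    · exact Subgroup.mem_sup_left ⟨g, rfl⟩
    · exact Subgroup.mem_sup_right ⟨g, rfl⟩
  | base g =>
    exact Subgroup.mem_sup_left ⟨g, Monoid.PushoutI.of_apply_eq_base _ false g⟩
  | mul x y hx hy => exact mul_mem (hx trivial) (hy trivial)

/-- The (realized) Bass–Serre tree of the splitting of `Amalgam G n`. -/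
abbrev BSTree (G : ℕ → Subgroup M) (n : ℕ) : Type _ :=
  CosetGraph (edgeGroup_le G n) (edgeGroup_le' G n)

/-- The metric on the Bass–Serre tree in which every edge has length `1 / 2 ^ n`. -/
instance BSTree.instMetricSpace (G : ℕ → Subgroup M) (n : ℕ) : MetricSpace (BSTree G n) :=
  Realization.metricSpace _ _ (1 / 2 ^ n) (by positivity)
    (CosetGraph.connected _ _ (range_sup_range G n))

theorem phi_edgeGroup (G : ℕ → Subgroup M) (a : ℕ → M) (hG : Monotone G) (h : CondP1 G a) (n : ℕ)
    {c : Amalgam G n} (hc : c ∈ edgeGroup G n) :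
    phi G a hG h n c ∈ edgeGroup G (n + 1) ∧
      phi G a hG h n c * inM' G (n + 1) (a (n + 1)) =
        inM' G (n + 1) (a (n + 1)) * phi G a hG h n c := by
  obtain ⟨g, hg, rfl⟩ := hc
  have hg' : g ∈ G (n + 1) := hG n.le_succ hg
  rw [phi_inM]
  refine ⟨⟨g, hg', rfl⟩, ?_⟩
  rw [inM_eq_inM' G (n + 1) hg', inM'_comm h n hg]

/-- The image of the first half of an edge: `g C ↦ φ(g) C'`. -/
def firstHalf (G : ℕ → Subgroup M) (a : ℕ → M) (hG : Monotone G) (h : CondP1 G a) (n : ℕ) :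
    Amalgam G n ⧸ edgeGroup G n → Amalgam G (n + 1) ⧸ edgeGroup G (n + 1) :=
  Quotient.map' (phi G a hG h n) fun g g' hg => by
    rw [QuotientGroup.leftRel_apply] at hg ⊢
    simpa using (phi_edgeGroup G a hG h n hg).1

/-- The image of the second half of an edge: `g C ↦ φ(g) β(a) C'`. -/
def secondHalf (G : ℕ → Subgroup M) (a : ℕ → M) (hG : Monotone G) (h : CondP1 G a) (n : ℕ) :
    Amalgam G n ⧸ edgeGroup G n → Amalgam G (n + 1) ⧸ edgeGroup G (n + 1) :=
  Quotient.map' (fun g => phi G a hG h n g * inM' G (n + 1) (a (n + 1))) fun g g' hg => by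
    rw [QuotientGroup.leftRel_apply] at hg ⊢
    have := phi_edgeGroup G a hG h n hg
    rw [map_mul, map_inv] at this
    have e : (phi G a hG h n g * inM' G (n + 1) (a (n + 1)))⁻¹ *
        (phi G a hG h n g' * inM' G (n + 1) (a (n + 1)))
        = (phi G a hG h n g)⁻¹ * phi G a hG h n g' := by
      rw [mul_inv_rev, mul_assoc, ← mul_assoc _ (phi G a hG h n g'), this.2, inv_mul_cancel_left]
    rw [e]
    exact this.1

/-- The folding map on a single edge. The edge is subdivided at its midpoint, which is sent to a
vertex of the second type; both halves are sent linearly onto edges. -/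
def foldEdge (G : ℕ → Subgroup M) (a : ℕ → M) (hG : Monotone G) (h : CondP1 G a) (n : ℕ)
    (e : Amalgam G n ⧸ edgeGroup G n) (s : unitInterval) : BSTree G (n + 1) :=
  if (s : ℝ) ≤ 1 / 2 then
    Realization.pt _ _ (firstHalf G a hG h n e) (Set.projIcc 0 1 zero_le_one (2 * (s : ℝ)))
  else
    Realization.pt _ _ (secondHalf G a hG h n e) (Set.projIcc 0 1 zero_le_one (2 - 2 * (s : ℝ)))

/-- The map `φ_n` from the `n`-th Bass–Serre tree to the next one. -/
def foldMap (G : ℕ → Subgroup M) (a : ℕ → M) (hG : Monotone G) (h : CondP1 G a) (n : ℕ) :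
    BSTree G n → BSTree G (n + 1) :=
  Quotient.lift (fun p => foldEdge G a hG h n p.1 p.2) (by
    rintro ⟨e, s⟩ ⟨e', s'⟩ ⟨hs, h0, h1, h2⟩
    dsimp only at *
    subst hs
    by_cases hs0 : s = 0
    · subst hs0
      obtain ⟨g, rfl⟩ := QuotientGroup.mk_surjective e
      obtain ⟨g', rfl⟩ := QuotientGroup.mk_surjective e'
      obtain ⟨m, hm⟩ := QuotientGroup.eq.1 (h0 rfl)
      simp only [foldEdge, Set.Icc.coe_zero, one_div, inv_nonneg, Nat.ofNat_nonneg, if_true,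
        mul_zero, Set.projIcc_left]
      refine Quotient.sound ⟨rfl, fun _ => QuotientGroup.eq.2 ⟨m, ?_⟩,
        fun h => absurd h (by simp), fun h => absurd (by simp) h⟩
      rw [← phi_inM G a hG h, hm, map_mul, map_inv]
      rfl
    · by_cases hs1 : s = 1
      · subst hs1
        obtain ⟨g, rfl⟩ := QuotientGroup.mk_surjective e
        obtain ⟨g', rfl⟩ := QuotientGroup.mk_surjective e'
        obtain ⟨m, hm⟩ := QuotientGroup.eq.1 (h1 rfl)
        have hle : ¬ ((1 : ℝ) ≤ 1 / 2) := by norm_num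
        simp only [foldEdge, Set.Icc.coe_one, if_neg hle, mul_one, sub_self, Set.projIcc_left]
        refine Quotient.sound ⟨rfl, fun _ => QuotientGroup.eq.2 ⟨m, ?_⟩,
          fun h => absurd h (by simp), fun h => absurd (by simp) h⟩
        have := phi_inM' G a hG h n m
        rw [hm, map_mul, map_inv] at this
        change _ = (phi G a hG h n g * inM' G (n + 1) (a (n + 1)))⁻¹ *
          (phi G a hG h n g' * inM' G (n + 1) (a (n + 1)))
        have this' : (phi G a hG h n g)⁻¹ * phi G a hG h n g' = _ := this
        rw [mul_inv_rev, mul_assoc, ← mul_assoc _ (phi G a hG h n g'), this']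
        group
      · rw [h2 hs0 hs1])

theorem foldMap_pt (G : ℕ → Subgroup M) (a : ℕ → M) (hG : Monotone G) (h : CondP1 G a) (n : ℕ)
    (e : Amalgam G n ⧸ edgeGroup G n) (s : unitInterval) :
    foldMap G a hG h n (Realization.pt _ _ e s) = foldEdge G a hG h n e s := rfl

theorem foldEdge_mid (G : ℕ → Subgroup M) (a : ℕ → M) (hG : Monotone G) (h : CondP1 G a) (n : ℕ)
    (e : Amalgam G n ⧸ edgeGroup G n) :
    (Realization.pt _ _ (firstHalf G a hG h n e) 1 : BSTree G (n + 1)) =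
      Realization.pt _ _ (secondHalf G a hG h n e) 1 := by
  obtain ⟨g, rfl⟩ := QuotientGroup.mk_surjective e
  refine Quotient.sound ⟨rfl, fun h => absurd h (by simp),
    fun _ => QuotientGroup.eq.2 ⟨a (n + 1), ?_⟩, fun _ h => absurd rfl h⟩
  simp

theorem foldEdge_hasPath_aux (G : ℕ → Subgroup M) (a : ℕ → M) (hG : Monotone G) (h : CondP1 G a)
    (n : ℕ) (e : Amalgam G n ⧸ edgeGroup G n) (s u : unitInterval) (hsu : s ≤ u) :
    HasPath _ _ (foldEdge G a hG h n e s) (foldEdge G a hG h n e u) (2 * |(s : ℝ) - u|) := by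
  have s0 := s.2.1
  have u1 := u.2.2
  have hsu' : (s : ℝ) ≤ u := hsu
  unfold foldEdge
  split_ifs with hs hu hu
  · convert HasPath.edge _ _ _ using 1
    rw [Set.projIcc_of_mem _ (⟨by linarith, by linarith⟩ : 2 * (s : ℝ) ∈ Set.Icc (0 : ℝ) 1),
      Set.projIcc_of_mem _ (⟨by linarith, by linarith⟩ : 2 * (u : ℝ) ∈ Set.Icc (0 : ℝ) 1)]
    rw [← mul_sub, abs_mul, abs_two]
  · have e1 := HasPath.edge (o := Subgroup.quotientMapOfLE (edgeGroup_le G (n + 1)))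
      (t := Subgroup.quotientMapOfLE (edgeGroup_le' G (n + 1))) (firstHalf G a hG h n e)
      (Set.projIcc 0 1 zero_le_one (2 * (s : ℝ))) 1
    have e2 := HasPath.edge (o := Subgroup.quotientMapOfLE (edgeGroup_le G (n + 1)))
      (t := Subgroup.quotientMapOfLE (edgeGroup_le' G (n + 1))) (secondHalf G a hG h n e)
      1 (Set.projIcc 0 1 zero_le_one (2 - 2 * (u : ℝ)))
    rw [← foldEdge_mid] at e2
    convert e1.trans e2 using 1
    rw [Set.projIcc_of_mem _ (⟨by linarith, by linarith⟩ : 2 * (s : ℝ) ∈ Set.Icc (0 : ℝ) 1),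
      Set.projIcc_of_mem _ (⟨by linarith, by linarith⟩ : 2 - 2 * (u : ℝ) ∈ Set.Icc (0 : ℝ) 1)]
    simp only [Set.Icc.coe_one]
    rw [abs_of_nonpos (by linarith), abs_of_nonpos (by linarith), abs_of_nonneg (by linarith)]
    ring
  · exact absurd (hsu'.trans hu) hs
  · convert HasPath.edge _ _ _ using 1
    rw [Set.projIcc_of_mem _ (⟨by linarith, by linarith⟩ : 2 - 2 * (s : ℝ) ∈ Set.Icc (0 : ℝ) 1),
      Set.projIcc_of_mem _ (⟨by linarith, by linarith⟩ : 2 - 2 * (u : ℝ) ∈ Set.Icc (0 : ℝ) 1)]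
    rw [sub_sub_sub_cancel_left, ← mul_sub, abs_mul, abs_two, abs_sub_comm]

theorem foldMap_hasPath (G : ℕ → Subgroup M) (a : ℕ → M) (hG : Monotone G) (h : CondP1 G a)
    (n : ℕ) {x y : BSTree G n} {r : ℝ} (hr : HasPath _ _ x y r) :
    HasPath _ _ (foldMap G a hG h n x) (foldMap G a hG h n y) (2 * r) := by
  induction hr with
  | nil x => rw [mul_zero]; exact .nil _
  | cons e s u y r _ ih =>
    rw [mul_add]
    refine HasPath.trans ?_ ih
    rcases le_total s u with hsu | hsu
    · exact foldEdge_hasPath_aux G a hG h n e s u hsu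
    · rw [abs_sub_comm]
      exact (foldEdge_hasPath_aux G a hG h n e u s hsu).symm

theorem foldMap_lipschitz (G : ℕ → Subgroup M) (a : ℕ → M) (hG : Monotone G) (h : CondP1 G a)
    (n : ℕ) : LipschitzWith 1 (foldMap G a hG h n) := by
  refine LipschitzWith.of_dist_le_mul fun x y => ?_
  rw [NNReal.coe_one, one_mul]
  change 1 / 2 ^ (n + 1) * simplicialDist _ _ _ _ ≤ 1 / 2 ^ n * simplicialDist _ _ _ _
  have : simplicialDist _ _ (foldMap G a hG h n x) (foldMap G a hG h n y) / 2
      ≤ simplicialDist _ _ x y :=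
    le_csInf (CosetGraph.connected _ _ (range_sup_range G n) x y) fun r hr => by
      have := (foldMap_hasPath G a hG h n hr).simplicialDist_le
      linarith
  have hpos : (0 : ℝ) < 1 / 2 ^ n := by positivity
  calc (1 : ℝ) / 2 ^ (n + 1) * simplicialDist _ _ (foldMap G a hG h n x) (foldMap G a hG h n y)
      = 1 / 2 ^ n * (simplicialDist _ _ (foldMap G a hG h n x) (foldMap G a hG h n y) / 2) := by
        rw [pow_succ]; field_simp
    _ ≤ _ := mul_le_mul_of_nonneg_left this hpos.le

/-- The limit space `T` of the sequence of Bass–Serre trees. -/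
abbrev LimitTree (G : ℕ → Subgroup M) (a : ℕ → M) (hG : Monotone G) (h : CondP1 G a) : Type _ :=
  LimitSpace (foldMap G a hG h) (foldMap_lipschitz G a hG h)

/-- The natural map from the first Bass–Serre tree to the limit space. -/
def theta (G : ℕ → Subgroup M) (a : ℕ → M) (hG : Monotone G) (h : CondP1 G a) (x : BSTree G 0) :
    LimitTree G a hG h := toLimit (foldMap G a hG h) (foldMap_lipschitz G a hG h) x

end Data

/-- The pointwise stabilizer of a set, for an isometric action given as a homomorphism. -/
def pointwiseStabilizer {L X : Type*} [Group L] [MetricSpace X] (ρ : L →* (X ≃ᵢ X)) (A : Set X) :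
    Subgroup L where
  carrier := {g | ∀ z ∈ A, ρ g z = z}
  one_mem' z _ := by simp
  mul_mem' {g g'} hg hg' z hz := by
    rw [map_mul, IsometryEquiv.mul_apply, hg' z hz, hg z hz]
  inv_mem' {g} hg z hz := by
    rw [map_inv]
    exact (IsometryEquiv.symm_apply_eq (ρ g)).2 (hg z hz).symm

end

end StrongLimit

open StrongLimit

/-!
Folding replaces each edge of a path in a Bass–Serre tree by two edges, so the path, read as a word
in the elements of `M` by which it turns at its vertices, acquires letters `a i` and `(a i)⁻¹` in
alternation. The path of a word without interior letters in `G n` is geodesic. A letter outside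
`⋃ G k` is never folded. A letter of `G (k + 1)` outside `G k` is folded in the tree of index
`k + 1`, where it merges with its neighbours `a (k + 1)` and `(a (k + 1))⁻¹` into a letter that, by
(P4), lies outside `⋃ G k`. The number of letters inside `⋃ G k` therefore drops at every fold, and
after finitely many folds the distance of two points no longer changes.

A limit of trees satisfies the four point condition, and the stable segments provide geodesics, so
the limit is an `ℝ`-tree. Letters equal to `a 1` are never folded, which gives elements with
unbounded orbits. An arc of the limit contains the image of a full edge of some tree. An element
which fixes this edge only in a later tree fixes the midpoint of the folded edge as well, and going
back one tree at a time one finds that it already fixed the edge up to an element of the kernel.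
Hence the arc stabilizer embeds into the stabilizer of the edge, a conjugate of some `G m`.
-/

namespace StrongLimit

/-! ### Geodesic spaces satisfying the four point condition -/

section FourPoint

/-- The four point condition, i.e. `0`-hyperbolicity in the sense of Gromov. Together with the
existence of geodesics it characterizes `ℝ`-trees, and unlike the existence of geodesics it passes
to limits. -/
def FourPoint (X : Type*) [MetricSpace X] : Prop :=
  ∀ x y z w : X, dist x y + dist z w ≤ max (dist x z + dist y w) (dist x w + dist y z)

/-- `MetricBtw x z y`: the point `z` lies metrically between `x` and `y`, the middle argument being
the intermediate point. -/
def MetricBtw {X : Type*} [MetricSpace X] (x z y : X) : Prop := dist x z + dist z y = dist x y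

variable {X : Type*} [MetricSpace X] {x y z w : X}

theorem MetricBtw.symm (h : MetricBtw x z y) : MetricBtw y z x := by
  unfold MetricBtw at *
  rw [dist_comm y z, dist_comm z x, dist_comm y x, add_comm, h]

theorem metricBtw_left (x y : X) : MetricBtw x x y := by
  rw [MetricBtw, dist_self, zero_add]

theorem metricBtw_right (x y : X) : MetricBtw x y y := by
  rw [MetricBtw, dist_self, add_zero]

theorem metricBtw_self_iff : MetricBtw x z x ↔ z = x := by
  rw [MetricBtw, dist_self, dist_comm z x, ← two_mul, mul_eq_zero_iff_left two_ne_zero,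
    dist_eq_zero, eq_comm]

theorem MetricBtw.trans_left (h : MetricBtw x z y) (hw : MetricBtw x w z) : MetricBtw x w y := by
  unfold MetricBtw at *
  linarith [dist_triangle x w y, dist_triangle w z y]

theorem MetricBtw.trans_right (h : MetricBtw x z y) (hw : MetricBtw x w z) : MetricBtw w z y := by
  unfold MetricBtw at *
  linarith [dist_triangle x w y, dist_triangle w z y]

theorem FourPoint.dist_eq_max (hX : FourPoint X) (w : X) (h : MetricBtw x z y) :
    dist w z = max (dist w x - dist x z) (dist w y - dist z y) := by
  unfold MetricBtw at h
  refine le_antisymm (le_max_iff.2 ?_) (max_le ?_ ?_)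
  · exact (le_max_iff.1 (hX w z x y)).imp (fun h => by linarith)
      (fun h => by linarith [dist_comm z x])
  · linarith [dist_triangle w z x, dist_comm z x]
  · linarith [dist_triangle w z y]

theorem FourPoint.metricBtw_trans (hX : FourPoint X) (hxyz : MetricBtw x y z)
    (hyzw : MetricBtw y z w) (hyz : y ≠ z) : MetricBtw x z w := by
  unfold MetricBtw at *
  have hpos := dist_pos.2 hyz
  refine le_antisymm ?_ (dist_triangle _ _ _)
  rcases le_max_iff.1 (hX x z y w) with h | h <;> linarith [dist_comm z y]

theorem FourPoint.metricBtw_of_le (hX : FourPoint X) (hz : MetricBtw x z y) (hw : MetricBtw x w y)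
    (h : dist x z ≤ dist x w) : MetricBtw x z w := by
  have hwz := hX.dist_eq_max w hz
  unfold MetricBtw at *
  rcases max_choice (dist w x - dist x z) (dist w y - dist z y) with hm | hm <;>
    linarith [dist_comm w x, dist_comm w z, dist_nonneg (x := w) (y := z)]

theorem FourPoint.eq_of_metricBtw (hX : FourPoint X) (hz : MetricBtw x z y) (hw : MetricBtw x w y)
    (h : dist x z = dist x w) : z = w := by
  have hzw : dist x z + dist z w = dist x w := hX.metricBtw_of_le hz hw h.le
  exact dist_le_zero.1 (by linarith)

theorem FourPoint.metricBtw_of_dist_le (hX : FourPoint X) (h : MetricBtw x z y)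
    (hw : dist x w ≤ dist x z) : MetricBtw w z y := by
  unfold MetricBtw at *
  rcases le_max_iff.1 (hX w z x y) with hle | hle
  · have hwz : w = z := dist_le_zero.1 (by linarith [dist_comm w x])
    rw [hwz, dist_self, zero_add]
  · exact le_antisymm (by linarith [dist_comm z x]) (dist_triangle _ _ _)

theorem FourPoint.metricBtw_or_metricBtw (hX : FourPoint X) (hz : MetricBtw x z y)
    (hw : MetricBtw x w y) : MetricBtw x w z ∨ MetricBtw z w y := by
  rcases le_total (dist x w) (dist x z) with h | h
  · exact .inl (hX.metricBtw_of_le hw hz h)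
  · exact .inr (hw.trans_right (hX.metricBtw_of_le hz hw h))

theorem MetricBtw.metricBtw_iff_of_fourPoint (hX : FourPoint X) (h : MetricBtw x z y) :
    MetricBtw x w y ↔ MetricBtw x w z ∨ MetricBtw z w y :=
  ⟨fun hw => hX.metricBtw_or_metricBtw h hw,
    fun hw => hw.elim h.trans_left fun hw => (h.symm.trans_left hw.symm).symm⟩

theorem FourPoint.metricBtw_center_iff (hX : FourPoint X) {c : X} (hxy : MetricBtw x c y)
    (hxz : MetricBtw x c z) (hyz : MetricBtw y c z) :
    MetricBtw x w c ↔ MetricBtw x w y ∧ MetricBtw x w z := by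
  refine ⟨fun h => ⟨hxy.trans_left h, hxz.trans_left h⟩, fun ⟨hwy, hwz⟩ => ?_⟩
  rcases hX.metricBtw_or_metricBtw hxy hwy with h | hcy
  · exact h
  rcases hX.metricBtw_or_metricBtw hxz hwz with h | hcz
  · exact h
  have hwc : w = c := by
    unfold MetricBtw at hcy hcz hyz
    exact dist_le_zero.1 (by
      linarith [dist_triangle y w z, dist_comm y c, dist_comm y w, dist_comm w c])
  exact hwc ▸ metricBtw_right x w

section Geodesic

variable {γ δ : ℝ → X} {ℓ m r s t : ℝ}

theorem IsGeodesic.dist_of_le (h : IsGeodesic γ ℓ) (hs : 0 ≤ s) (hst : s ≤ t) (ht : t ≤ ℓ) :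
    dist (γ s) (γ t) = t - s := by
  rw [h.2 s ⟨hs, hst.trans ht⟩ t ⟨hs.trans hst, ht⟩, abs_sub_comm, abs_of_nonneg (sub_nonneg.2 hst)]

theorem IsGeodesic.dist_zero (h : IsGeodesic γ ℓ) (ht : t ∈ Set.Icc 0 ℓ) :
    dist (γ 0) (γ t) = t := by
  rw [h.dist_of_le le_rfl ht.1 ht.2, sub_zero]

theorem IsGeodesic.dist_eq (h : IsGeodesic γ ℓ) : dist (γ 0) (γ ℓ) = ℓ :=
  h.dist_zero ⟨h.1, le_rfl⟩

theorem IsGeodesic.metricBtw (h : IsGeodesic γ ℓ) (ht : t ∈ Set.Icc 0 ℓ) :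
    MetricBtw (γ 0) (γ t) (γ ℓ) := by
  rw [MetricBtw, h.dist_zero ht, h.dist_of_le ht.1 ht.2 le_rfl, h.dist_eq, add_sub_cancel]

theorem IsGeodesic.dist_of_concat (hγ : IsGeodesic γ ℓ) (hδ : IsGeodesic δ m) (h0 : γ ℓ = δ 0)
    (h : MetricBtw (γ 0) (γ ℓ) (δ m)) (hs : s ∈ Set.Icc 0 ℓ) (ht : t ∈ Set.Icc 0 m) :
    dist (γ s) (δ t) = ℓ - s + t := by
  have hsℓ := hγ.dist_of_le hs.1 hs.2 le_rfl
  have htm := hδ.dist_of_le ht.1 ht.2 le_rfl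
  have h0s := hγ.dist_zero hs
  have h0t := hδ.dist_zero ht
  have hlen : ℓ + m = dist (γ 0) (δ m) := by
    rw [← h, h0, hδ.dist_eq, ← h0, hγ.dist_eq]
  rw [h0] at hsℓ
  apply le_antisymm
  · linarith [dist_triangle (γ s) (δ 0) (δ t)]
  · linarith [dist_triangle (γ 0) (γ s) (δ m), dist_triangle (γ s) (δ t) (δ m)]

theorem IsGeodesic.concat (hγ : IsGeodesic γ ℓ) (hδ : IsGeodesic δ m) (h0 : γ ℓ = δ 0)
    (h : MetricBtw (γ 0) (γ ℓ) (δ m)) :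
    IsGeodesic (fun t => if t ≤ ℓ then γ t else δ (t - ℓ)) (ℓ + m) := by
  refine ⟨add_nonneg hγ.1 hδ.1, fun s hs t ht => ?_⟩
  wlog hst : s ≤ t generalizing s t
  · rw [dist_comm, abs_sub_comm]
    exact this t ht s hs (le_of_not_ge hst)
  rw [abs_sub_comm, abs_of_nonneg (sub_nonneg.2 hst)]
  dsimp only
  split_ifs with hsℓ htℓ htℓ
  · exact hγ.dist_of_le hs.1 hst htℓ
  · rw [hγ.dist_of_concat hδ h0 h ⟨hs.1, hsℓ⟩ ⟨by linarith, by linarith [ht.2]⟩]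
    ring
  · exact absurd (hst.trans htℓ) hsℓ
  · rw [hδ.dist_of_le (by linarith) (by linarith) (by linarith [ht.2])]
    ring

end Geodesic

theorem IsSegment.concat (hxy : ∃ A, IsSegment A x y) (hyz : ∃ A, IsSegment A y z)
    (h : MetricBtw x y z) : ∃ A, IsSegment A x z := by
  obtain ⟨_, γ, ℓ, hγ, rfl, rfl, -⟩ := hxy
  obtain ⟨_, δ, m, hδ, h0, rfl, -⟩ := hyz
  refine ⟨_, _, _, hγ.concat hδ h0.symm h, if_pos hγ.1, ?_, rfl⟩
  split_ifs with hm
  · rw [le_antisymm (by linarith) hδ.1, add_zero, h0]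
  · rw [add_sub_cancel_left]

theorem IsSegment.symm {A : Set X} (h : IsSegment A x y) : IsSegment A y x := by
  obtain ⟨γ, ℓ, hγ, rfl, rfl, rfl⟩ := h
  refine ⟨fun t => γ (ℓ - t), ℓ, ⟨hγ.1, fun s hs t ht => ?_⟩, congrArg γ (sub_zero ℓ),
    congrArg γ (sub_self ℓ), ?_⟩
  · rw [hγ.2 _ ⟨sub_nonneg.2 hs.2, sub_le_self _ hs.1⟩ _ ⟨sub_nonneg.2 ht.2, sub_le_self _ ht.1⟩,
      sub_sub_sub_cancel_left, abs_sub_comm]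
  · rw [← Set.image_image γ (ℓ - ·), Set.image_const_sub_Icc, sub_self, sub_zero]

theorem IsSegment.exists_metricBtw_dist_eq (h : ∃ A, IsSegment A x y) {r : ℝ} (hr : 0 ≤ r)
    (hr' : r ≤ dist x y) : ∃ z, MetricBtw x z y ∧ dist x z = r := by
  obtain ⟨_, γ, ℓ, hγ, rfl, rfl, -⟩ := h
  have hmem : r ∈ Set.Icc 0 ℓ := ⟨hr, hr'.trans_eq hγ.dist_eq⟩
  exact ⟨γ r, hγ.metricBtw hmem, hγ.dist_zero hmem⟩

theorem FourPoint.isSegment_eq (hX : FourPoint X) {A : Set X} (h : IsSegment A x y) :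
    A = {z | MetricBtw x z y} := by
  obtain ⟨γ, ℓ, hγ, rfl, rfl, rfl⟩ := h
  ext z
  refine ⟨fun ⟨t, ht, hz⟩ => hz ▸ hγ.metricBtw ht, fun hz => ?_⟩
  have hmem : dist (γ 0) z ∈ Set.Icc 0 ℓ := by
    refine ⟨dist_nonneg, ?_⟩
    rw [← hγ.dist_eq, ← hz]
    exact le_add_of_nonneg_right dist_nonneg
  exact ⟨_, hmem, hX.eq_of_metricBtw (hγ.metricBtw hmem) hz (hγ.dist_zero hmem)⟩

theorem FourPoint.exists_center (hX : FourPoint X) (z : X) (h : ∃ A, IsSegment A x y) :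
    ∃ c, MetricBtw x c y ∧ MetricBtw x c z ∧ MetricBtw y c z := by
  -- The center lies on `[x, y]` at distance the Gromov product `(y | z)_x` from `x`.
  obtain ⟨c, hc, hxc⟩ := IsSegment.exists_metricBtw_dist_eq h
    (r := (dist x y + dist x z - dist y z) / 2)
    (by linarith [dist_triangle y x z, dist_comm y x])
    (by linarith [dist_triangle x y z])
  have hzc := hX.dist_eq_max z hc
  rw [max_eq_left (by unfold MetricBtw at hc; linarith [dist_comm z x, dist_comm z y])] at hzc
  refine ⟨c, hc, ?_, ?_⟩ <;> unfold MetricBtw at * <;>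
    linarith [dist_comm z x, dist_comm z c, dist_comm y c]

theorem FourPoint.isRTree (hX : FourPoint X) (hg : ∀ x y : X, ∃ A, IsSegment A x y) :
    IsRTree X := by
  refine ⟨hg, fun x y z A B hA hB => ?_, fun x y z A B hA hB hAB => ?_⟩ <;>
    obtain ⟨c, hxy, hxz, hyz⟩ := hX.exists_center z ⟨A, hA⟩ <;>
    rw [hX.isSegment_eq hA, hX.isSegment_eq hB] at *
  · obtain ⟨C, hC⟩ := hg x c
    refine ⟨x, c, ?_⟩
    convert hC using 1
    rw [hX.isSegment_eq hC]
    exact Set.ext fun w => (hX.metricBtw_center_iff hxy hxz hyz).symm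
  · have hcx : c ∈ ({x} : Set X) := hAB ▸ ⟨hxy, hxz⟩
    obtain rfl : c = x := hcx
    obtain ⟨C, hC⟩ := hg y z
    refine ⟨y, z, ?_⟩
    convert hC using 1
    rw [hX.isSegment_eq hC]
    ext w
    rw [Set.mem_ofPred_eq, hyz.metricBtw_iff_of_fourPoint hX]
    exact or_congr_left ⟨MetricBtw.symm, MetricBtw.symm⟩

end FourPoint

/-! ### Chains of geodesic pieces -/

section Chain

variable {X : Type*} [MetricSpace X] {R : X → X → Prop} {x y z w c : X}

/-- `Chain R x z`: the points `x` and `z` are joined by a geodesic that is a concatenation of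
finitely many pieces with `R`-related endpoints, each piece being given by its endpoints only. -/
inductive Chain (R : X → X → Prop) : X → X → Prop
  | nil (x : X) : Chain R x x
  | cons (x y z : X) : R x y → MetricBtw x y z → Chain R y z → Chain R x z

/-- The relations used as pieces of chains: symmetric, inherited by subsegments, and such that
related points are joined by a geodesic segment. -/
structure IsPiece (R : X → X → Prop) : Prop where
  symm : ∀ x y, R x y → R y x
  left : ∀ x c y, R x y → MetricBtw x c y → R x c
  segment : ∀ x y, R x y → ∃ A, IsSegment A x y

theorem IsPiece.right (hR : IsPiece R) (h : R x y) (hc : MetricBtw x c y) : R c y :=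
  hR.symm _ _ (hR.left _ _ _ (hR.symm _ _ h) hc.symm)

theorem IsPiece.of_metricBtw (hR : IsPiece R) (hX : FourPoint X) (h : R x y)
    (hz : MetricBtw x z y) (hw : MetricBtw x w y) : R z w := by
  wlog hzw : dist x z ≤ dist x w generalizing z w
  · exact hR.symm _ _ (this hw hz (le_of_not_ge hzw))
  exact hR.right (hR.left _ _ _ h hw) (hX.metricBtw_of_le hz hw hzw)

theorem Chain.mono {R' : X → X → Prop} (hR : ∀ x y, R x y → R' x y) (h : Chain R x y) :
    Chain R' x y := by
  induction h with
  | nil x => exact .nil x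
  | cons x y z hxy hb _ ih => exact .cons x y z (hR x y hxy) hb ih

theorem Chain.right (hX : FourPoint X) (hR : IsPiece R) (h : Chain R x z) (hc : MetricBtw x c z) :
    Chain R c z := by
  induction h with
  | nil x =>
    rw [metricBtw_self_iff.1 hc]
    exact .nil x
  | cons x y z hxy hb hyz ih =>
    rcases hX.metricBtw_or_metricBtw hb hc with h | h
    · exact .cons c y z (hR.right hxy h) (hb.trans_right h) hyz
    · exact ih h

theorem Chain.trans_piece (hX : FourPoint X) (hR : IsPiece R) (hxy : R x y) (h : Chain R y z) :
    Chain R x z := by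
  obtain ⟨c, hcy, hcz, hyc⟩ := hX.exists_center z (hR.segment _ _ hxy)
  exact .cons x c z (hR.left _ _ _ hxy hcy) hcz (h.right hX hR hyc)

theorem isSegment_singleton (x : X) : IsSegment {x} x x := by
  refine ⟨fun _ => x, 0, ⟨le_rfl, fun s hs t ht => ?_⟩, rfl, rfl, by simp⟩
  rw [Set.Icc_self, Set.mem_singleton_iff] at hs ht
  rw [hs, ht, dist_self, sub_self, abs_zero]

theorem Chain.exists_isSegment (hR : ∀ x y, R x y → ∃ A, IsSegment A x y) (h : Chain R x z) :
    ∃ A, IsSegment A x z := by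
  induction h with
  | nil x => exact ⟨_, isSegment_singleton x⟩
  | cons x y z hxy hb _ ih => exact IsSegment.concat (hR x y hxy) ih hb

theorem Chain.exists_subdivision (hX : FourPoint X) (hR : IsPiece R) (h : Chain R x z) :
    ∃ (n : ℕ) (t : ℕ → ℝ), Monotone t ∧ t 0 = 0 ∧ t n = dist x z ∧
      ∀ k < n, ∀ w w' : X, MetricBtw x w z → MetricBtw x w' z →
        dist x w ∈ Set.Icc (t k) (t (k + 1)) → dist x w' ∈ Set.Icc (t k) (t (k + 1)) → R w w' := by
  induction h with
  | nil x => exact ⟨0, fun _ => 0, monotone_const, rfl, (dist_self x).symm, by simp⟩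
  | cons x y z hxy hb _ ih =>
    obtain ⟨n, t, hmono, h0, hn, hpiece⟩ := ih
    refine ⟨n + 1, fun k => Nat.casesOn k 0 fun k => dist x y + t k, ?_, rfl, ?_, ?_⟩
    · refine monotone_nat_of_le_succ fun k => ?_
      cases k with
      | zero =>
        change 0 ≤ dist x y + t 0
        rw [h0, add_zero]
        exact dist_nonneg
      | succ k => simpa using hmono (Nat.le_succ k)
    · change dist x y + t n = _
      rw [hn]
      exact hb
    · rintro (_ | k) hk w w' hw hw' hd hd'
      · have before : ∀ v, MetricBtw x v z → dist x v ≤ dist x y + t 0 → MetricBtw x v y :=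
          fun v hv hle => hX.metricBtw_of_le hv hb (by rwa [h0, add_zero] at hle)
        exact hR.of_metricBtw hX hxy (before w hw hd.2) (before w' hw' hd'.2)
      · have after : ∀ v, MetricBtw x v z →
            dist x v ∈ Set.Icc (dist x y + t k) (dist x y + t (k + 1)) →
            MetricBtw y v z ∧ dist y v ∈ Set.Icc (t k) (t (k + 1)) := by
          intro v hv hd
          have hk0 : 0 ≤ t k := h0 ▸ hmono (Nat.zero_le k)
          have hyv : MetricBtw x y v := hX.metricBtw_of_le hb hv (by linarith [hd.1])
          have hsum : dist x y + dist y v = dist x v := hyv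
          exact ⟨hv.trans_right hyv, by linarith [hd.1], by linarith [hd.2]⟩
        exact hpiece k (by omega) w w' (after w hw hd).1 (after w' hw' hd').1
          (after w hw hd).2 (after w' hw' hd').2

theorem Chain.exists_forall_of_forall_exists (hX : FourPoint X) {P : ℕ → X → Prop}
    (mono : ∀ ⦃k k'⦄, k ≤ k' → ∀ w, P k w → P k' w) (ev : ∀ w, ∃ k, P k w)
    (piece : ∀ k u v w, R u v → MetricBtw u w v → P k u → P k v → P k w) (h : Chain R x z) :
    ∃ k, ∀ w, MetricBtw x w z → P k w := by
  induction h with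
  | nil x => exact (ev x).imp fun k hk w hw => metricBtw_self_iff.1 hw ▸ hk
  | cons x y z hxy hb _ ih =>
    obtain ⟨k, hk⟩ := ih
    obtain ⟨kx, hkx⟩ := ev x
    refine ⟨max kx k, fun w hw => ?_⟩
    rcases hX.metricBtw_or_metricBtw hb hw with h | h
    · exact piece _ x y w hxy h (mono (le_max_left _ _) _ hkx)
        (mono (le_max_right _ _) _ (hk y (metricBtw_left y z)))
    · exact mono (le_max_right _ _) w (hk w h)

theorem isTreeMorphism_of_chain {Y : Type*} [MetricSpace Y] (hX : FourPoint X) (hR : IsPiece R)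
    (hc : ∀ x y : X, Chain R x y) (f : X → Y)
    (hf : ∀ x y, R x y → dist (f x) (f y) = dist x y) : IsTreeMorphism f := by
  intro γ ℓ hγ
  obtain ⟨n, t, hmono, h0, hn, hpiece⟩ := (hc (γ 0) (γ ℓ)).exists_subdivision hX hR
  rw [hγ.dist_eq] at hn
  refine ⟨n, t, hmono, h0, hn, fun k hk u hu v hv => hf _ _ ?_⟩
  have mem_Icc : ∀ u ∈ Set.Icc (t k) (t (k + 1)), u ∈ Set.Icc 0 ℓ := fun u hu =>
    ⟨(h0 ▸ hmono (Nat.zero_le k)).trans hu.1, hu.2.trans (hn ▸ hmono hk)⟩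
  refine hpiece k hk _ _ (hγ.metricBtw (mem_Icc u hu)) (hγ.metricBtw (mem_Icc v hv)) ?_ ?_
  · rwa [hγ.dist_zero (mem_Icc u hu)]
  · rwa [hγ.dist_zero (mem_Icc v hv)]

end Chain

/-! ### Realizations of trees -/

section TreeRealization

variable {E V W α : Type*} {o : E → V} {t : E → W} {e e' : E} {s s' u u' : unitInterval}

theorem Realization.pt_eq_pt_iff : Realization.pt o t e s = Realization.pt o t e' s' ↔
    s = s' ∧ (s = 0 → o e = o e') ∧ (s = 1 → t e = t e') ∧ (s ≠ 0 → s ≠ 1 → e = e') :=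
  Quotient.eq

theorem Realization.pt_zero_eq_pt_zero_iff :
    Realization.pt o t e 0 = Realization.pt o t e' 0 ↔ o e = o e' := by
  simp [Realization.pt_eq_pt_iff]

theorem Realization.pt_one_eq_pt_one_iff :
    Realization.pt o t e 1 = Realization.pt o t e' 1 ↔ t e = t e' := by
  simp [Realization.pt_eq_pt_iff]

theorem Realization.exists_eq_pt (x : Realization o t) : ∃ e s, x = Realization.pt o t e s := by
  obtain ⟨⟨e, s⟩, rfl⟩ := Quotient.exists_rep x
  exact ⟨e, s, rfl⟩

/-- The function on the realization which is given by `f e` on the edge `e`. -/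
def Realization.lift (f : E → unitInterval → α) (h0 : ∀ e e', o e = o e' → f e 0 = f e' 0)
    (h1 : ∀ e e', t e = t e' → f e 1 = f e' 1) : Realization o t → α :=
  Quotient.lift (fun p => f p.1 p.2) fun ⟨e, s⟩ ⟨e', s'⟩ h => by
    obtain ⟨rfl, h0', h1', h2⟩ := Realization.pt_eq_pt_iff.1 (Quotient.sound h)
    dsimp only
    by_cases hs0 : s = 0
    · exact hs0 ▸ h0 e e' (h0' hs0)
    by_cases hs1 : s = 1
    · exact hs1 ▸ h1 e e' (h1' hs1)
    · rw [h2 hs0 hs1]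

/-- A height function on the vertices of a bipartite graph which changes by one along every edge
and for which every vertex is the upper end of at most one edge. A connected graph with such a
function is a tree. -/
structure TreeHeight (o : E → V) (t : E → W) where
  hV : V → ℤ
  hW : W → ℤ
  diff : ∀ e, hW (t e) = hV (o e) + 1 ∨ hV (o e) = hW (t e) + 1
  uniqV : ∀ e e', o e = o e' → hV (o e) = hW (t e) + 1 → hV (o e') = hW (t e') + 1 → e = e'
  uniqW : ∀ e e', t e = t e' → hW (t e) = hV (o e) + 1 → hW (t e') = hV (o e') + 1 → e = e'

namespace TreeHeight

/-- The extension of the height to the realization which is affine on every edge. -/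
def height (H : TreeHeight o t) : Realization o t → ℝ :=
  Realization.lift (fun e s => (1 - (s : ℝ)) * H.hV (o e) + s * H.hW (t e))
    (fun e e' h => by simp [h]) (fun e e' h => by simp [h])

theorem height_pt (H : TreeHeight o t) (e : E) (s : unitInterval) :
    H.height (Realization.pt o t e s) = (1 - (s : ℝ)) * H.hV (o e) + s * H.hW (t e) := rfl

theorem abs_height_sub (H : TreeHeight o t) (e : E) (s u : unitInterval) :
    |H.height (Realization.pt o t e s) - H.height (Realization.pt o t e u)| = |(s : ℝ) - u| := by
  rcases H.diff e with h | h
  · congr 1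
    rw [height_pt, height_pt, h]
    push_cast
    ring
  · rw [abs_sub_comm]
    congr 1
    rw [height_pt, height_pt, h]
    push_cast
    ring

variable {H : TreeHeight o t} {x y z : Realization o t}

theorem height_pt_zero_le (h : H.hW (t e) = H.hV (o e) + 1) (s : unitInterval) :
    H.height (Realization.pt o t e 0) ≤ H.height (Realization.pt o t e s) := by
  rw [height_pt, height_pt, h]
  push_cast [Set.Icc.coe_zero]
  linarith [s.2.1]

theorem height_pt_one_le (h : H.hV (o e) = H.hW (t e) + 1) (s : unitInterval) :
    H.height (Realization.pt o t e 1) ≤ H.height (Realization.pt o t e s) := by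
  rw [height_pt, height_pt, h]
  push_cast [Set.Icc.coe_one]
  linarith [s.2.2]

theorem eq_of_height_pt_eq
    (h : H.height (Realization.pt o t e s) = H.height (Realization.pt o t e u)) : s = u := by
  have habs := H.abs_height_sub e s u
  rw [h, sub_self, abs_zero] at habs
  exact Subtype.ext (sub_eq_zero.1 (abs_eq_zero.1 habs.symm))

theorem eq_or_minimal_of_pt_eq_pt (H : TreeHeight o t)
    (h : Realization.pt o t e u = Realization.pt o t e' u') :
    u = u' ∧ (e = e' ∨ (∀ s, H.height (Realization.pt o t e u) ≤ H.height (Realization.pt o t e s))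
      ∨ ∀ s, H.height (Realization.pt o t e' u') ≤ H.height (Realization.pt o t e' s)) := by
  obtain ⟨rfl, h0, h1, h2⟩ := Realization.pt_eq_pt_iff.1 h
  refine ⟨rfl, ?_⟩
  by_cases hu0 : u = 0
  · subst hu0
    rcases H.diff e with hd | hd
    · exact .inr (.inl (height_pt_zero_le hd))
    rcases H.diff e' with hd' | hd'
    · exact .inr (.inr (height_pt_zero_le hd'))
    exact .inl (H.uniqV e e' (h0 rfl) hd hd')
  by_cases hu1 : u = 1
  · subst hu1
    rcases (H.diff e).symm with hd | hd
    · exact .inr (.inl (height_pt_one_le hd))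
    rcases (H.diff e').symm with hd' | hd'
    · exact .inr (.inr (height_pt_one_le hd'))
    exact .inl (H.uniqW e e' (h1 rfl) hd hd')
  · exact .inl (h2 hu0 hu1)

/-- `Below H z x`: the point `z` is reached from `x` along a path on which the height decreases.
This is the order of the tree rooted at an end at height `-∞` or at a vertex of minimal height. -/
inductive Below (H : TreeHeight o t) (z : Realization o t) : Realization o t → Prop
  | refl : Below H z z
  | step (e : E) (s u : unitInterval) : Below H z (Realization.pt o t e s) →
      H.height (Realization.pt o t e s) ≤ H.height (Realization.pt o t e u) →
      Below H z (Realization.pt o t e u)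

theorem Below.height_le (h : Below H z x) : H.height z ≤ H.height x := by
  induction h with
  | refl => exact le_rfl
  | step e s u _ hle ih => exact ih.trans hle

theorem Below.hasPath (h : Below H z x) : HasPath o t z x (H.height x - H.height z) := by
  induction h with
  | refl => rw [sub_self]; exact .nil z
  | step e s u _ hle ih =>
    convert ih.trans (HasPath.edge e s u) using 1
    rw [← H.abs_height_sub, abs_sub_comm, abs_of_nonneg (sub_nonneg.2 hle)]
    ring

theorem Below.trans (h : Below H z y) (h' : Below H y x) : Below H z x := by
  induction h' with
  | refl => exact h
  | step e s u _ hle ih => exact .step e s u ih hle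

theorem Below.below_pt_or (h : Below H z x) (hx : x = Realization.pt o t e u)
    (hle : H.height (Realization.pt o t e s) ≤ H.height (Realization.pt o t e u)) :
    Below H z (Realization.pt o t e s) ∨ Below H (Realization.pt o t e s) z := by
  induction h generalizing e s u with
  | refl => exact .inr (hx ▸ .step e s u .refl hle)
  | step e₁ s₁ u₁ hz hle₁ ih =>
    obtain ⟨rfl, rfl | hmin | hmin⟩ := H.eq_or_minimal_of_pt_eq_pt hx
    · rcases le_total (H.height (Realization.pt o t e₁ s)) (H.height (Realization.pt o t e₁ s₁))
        with h | h
      · exact ih rfl h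
      · exact .inl (.step e₁ s₁ s hz h)
    · obtain rfl : s₁ = u₁ := eq_of_height_pt_eq (le_antisymm hle₁ (hmin _))
      exact ih hx hle
    · obtain rfl : s = u₁ := eq_of_height_pt_eq (le_antisymm hle (hmin _))
      exact .inl (hx ▸ .step e₁ s₁ s hz hle₁)

theorem Below.total (h : Below H y x) (h' : Below H z x) : Below H y z ∨ Below H z y := by
  induction h with
  | refl => exact .inr h'
  | step e s u hy hle ih =>
    rcases h'.below_pt_or rfl hle with h | h
    · exact ih h
    · exact .inl (hy.trans h)

theorem exists_below (H : TreeHeight o t) (hc : ∀ x y : Realization o t, ∃ r, HasPath o t x y r)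
    (x y : Realization o t) : ∃ z, Below H z x ∧ Below H z y := by
  obtain ⟨r, h⟩ := hc x y
  induction h with
  | nil x => exact ⟨x, .refl, .refl⟩
  | cons e s u y _ _ ih =>
    obtain ⟨z, h1, h2⟩ := ih
    rcases le_total (H.height (Realization.pt o t e s)) (H.height (Realization.pt o t e u))
      with h | h
    · rcases h1.below_pt_or rfl h with h' | h'
      · exact ⟨z, h', h2⟩
      · exact ⟨_, .refl, h'.trans h2⟩
    · exact ⟨z, .step e u s h1 h, h2⟩

/-- The height of the highest common lower bound of two points. -/
noncomputable def meet (H : TreeHeight o t) (x y : Realization o t) : ℝ :=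
  sSup {r | ∃ z, Below H z x ∧ Below H z y ∧ r = H.height z}

theorem le_meet (hx : Below H z x) (hy : Below H z y) : H.height z ≤ H.meet x y :=
  le_csSup ⟨H.height x, by rintro _ ⟨w, h, -, rfl⟩; exact h.height_le⟩ ⟨z, hx, hy, rfl⟩

theorem meet_le (hc : ∀ x y : Realization o t, ∃ r, HasPath o t x y r) {r : ℝ}
    (h : ∀ z, Below H z x → Below H z y → H.height z ≤ r) : H.meet x y ≤ r := by
  refine csSup_le ?_ ?_
  · obtain ⟨z, hx, hy⟩ := H.exists_below hc x y
    exact ⟨_, z, hx, hy, rfl⟩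
  · rintro _ ⟨z, hx, hy, rfl⟩
    exact h z hx hy

theorem exists_below_of_lt_meet (hc : ∀ x y : Realization o t, ∃ r, HasPath o t x y r) {r : ℝ}
    (h : r < H.meet x y) : ∃ z, Below H z x ∧ Below H z y ∧ r < H.height z := by
  by_contra! hle
  exact h.not_ge (meet_le hc hle)

theorem meet_comm (H : TreeHeight o t) (x y : Realization o t) : H.meet x y = H.meet y x := by
  simp only [meet, and_left_comm]

theorem meet_ultra (H : TreeHeight o t) (hc : ∀ x y : Realization o t, ∃ r, HasPath o t x y r)
    (x y z : Realization o t) : H.meet x y ≤ H.meet x z ∨ H.meet y z ≤ H.meet x z := by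
  by_contra! h
  obtain ⟨u, hux, huy, hu⟩ := exists_below_of_lt_meet hc h.1
  obtain ⟨v, hvy, hvz, hv⟩ := exists_below_of_lt_meet hc h.2
  rcases huy.total hvy with h | h
  · exact hu.not_ge (le_meet hux (h.trans hvz))
  · exact hv.not_ge (le_meet (h.trans hux) hvz)

theorem height_add_height_sub_meet_le (hc : ∀ x y : Realization o t, ∃ r, HasPath o t x y r)
    {r : ℝ} (h : HasPath o t x y r) : H.height x + H.height y - 2 * H.meet x y ≤ r := by
  induction h with
  | nil x => linarith [le_meet (Below.refl (H := H) (z := x)) .refl]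
  | cons e s u y r _ ih =>
    have hmeet : H.meet (Realization.pt o t e u) y ≤ H.height (Realization.pt o t e u) :=
      meet_le hc fun z h _ => h.height_le
    have habs := H.abs_height_sub e s u
    have hultra := H.meet_ultra hc (Realization.pt o t e s) (Realization.pt o t e u) y
    rcases le_total (H.height (Realization.pt o t e s)) (H.height (Realization.pt o t e u))
      with h | h
    · rw [abs_of_nonpos (sub_nonpos.2 h)] at habs
      have hs : H.height (Realization.pt o t e s) ≤
          H.meet (Realization.pt o t e s) (Realization.pt o t e u) :=
        le_meet .refl (.step e s u .refl h)
      rcases hultra with h' | h' <;> linarith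
    · rw [abs_of_nonneg (sub_nonneg.2 h)] at habs
      have hu : H.height (Realization.pt o t e u) ≤
          H.meet (Realization.pt o t e s) (Realization.pt o t e u) :=
        le_meet (.step e u s .refl h) .refl
      rcases hultra with h' | h' <;> linarith

theorem simplicialDist_eq (H : TreeHeight o t)
    (hc : ∀ x y : Realization o t, ∃ r, HasPath o t x y r) (x y : Realization o t) :
    simplicialDist o t x y = H.height x + H.height y - 2 * H.meet x y := by
  apply le_antisymm
  · have hmeet : H.meet x y ≤ (H.height x + H.height y - simplicialDist o t x y) / 2 :=
      meet_le hc fun z hx hy => by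
        linarith [(hx.hasPath.symm.trans hy.hasPath).simplicialDist_le]
    linarith
  · exact le_csInf (hc x y) fun r hr => height_add_height_sub_meet_le hc hr

theorem simplicialDist_fourPoint (H : TreeHeight o t)
    (hc : ∀ x y : Realization o t, ∃ r, HasPath o t x y r) (x y z w : Realization o t) :
    simplicialDist o t x y + simplicialDist o t z w ≤
      max (simplicialDist o t x z + simplicialDist o t y w)
        (simplicialDist o t x w + simplicialDist o t y z) := by
  simp only [H.simplicialDist_eq hc]
  by_contra! h
  obtain ⟨h1, h2⟩ := max_lt_iff.1 h
  have hzy := H.meet_comm z y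
  have hwy := H.meet_comm w y
  have hzx := H.meet_comm z x
  rcases H.meet_ultra hc x z y with a | a <;>
  rcases H.meet_ultra hc x w y with b | b <;>
  rcases H.meet_ultra hc z x w with c | c <;>
  rcases H.meet_ultra hc z y w with d | d <;>
  linarith

theorem simplicialDist_pt (H : TreeHeight o t)
    (hc : ∀ x y : Realization o t, ∃ r, HasPath o t x y r) (e : E) (s u : unitInterval) :
    simplicialDist o t (Realization.pt o t e s) (Realization.pt o t e u) = |(s : ℝ) - u| := by
  refine le_antisymm (HasPath.edge e s u).simplicialDist_le (le_csInf (hc _ _) fun r hr => ?_)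
  rw [← H.abs_height_sub]
  exact hr.abs_sub_le _ fun e s u => (H.abs_height_sub e s u).le

end TreeHeight

open Classical in
theorem two_le_simplicialDist_pt_zero (hc : ∀ x y : Realization o t, ∃ r, HasPath o t x y r)
    (h : o e ≠ o e') :
    2 ≤ simplicialDist o t (Realization.pt o t e 0) (Realization.pt o t e' 0) := by
  -- `f` agrees with the distance to the vertex `o e` up to distance `2`.
  let f : Realization o t → ℝ := Realization.lift (fun e₁ s => if o e = o e₁ then s else 2 - s)
    (fun e₁ e₂ h => by simp only [h]) (fun _ _ _ => by norm_num)
  have hf : |f (.pt o t e 0) - f (.pt o t e' 0)| = 2 := by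
    change |(if o e = o e then (0 : ℝ) else 2 - 0) - if o e = o e' then (0 : ℝ) else 2 - 0| = 2
    rw [if_pos rfl, if_neg h]
    norm_num
  refine le_csInf (hc _ _) fun r hr => hf ▸ hr.abs_sub_le f fun e₁ s u => ?_
  change |(if o e = o e₁ then (s : ℝ) else 2 - s) - if o e = o e₁ then (u : ℝ) else 2 - u| ≤ _
  split_ifs
  · exact le_rfl
  · rw [sub_sub_sub_cancel_left, abs_sub_comm]

open Classical in
theorem two_le_simplicialDist_pt_one (hc : ∀ x y : Realization o t, ∃ r, HasPath o t x y r)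
    (h : t e ≠ t e') :
    2 ≤ simplicialDist o t (Realization.pt o t e 1) (Realization.pt o t e' 1) := by
  let f : Realization o t → ℝ := Realization.lift (fun e₁ s => if t e = t e₁ then s else -s)
    (fun _ _ _ => by norm_num) (fun e₁ e₂ h => by simp only [h])
  have hf : |f (.pt o t e 1) - f (.pt o t e' 1)| = 2 := by
    change |(if t e = t e then (1 : ℝ) else -1) - if t e = t e' then (1 : ℝ) else -1| = 2
    rw [if_pos rfl, if_neg h]
    norm_num
  refine le_csInf (hc _ _) fun r hr => hf ▸ hr.abs_sub_le f fun e₁ s u => ?_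
  change |(if t e = t e₁ then (s : ℝ) else -s) - if t e = t e₁ then (u : ℝ) else -u| ≤ _
  split_ifs
  · exact le_rfl
  · rw [neg_sub_neg, abs_sub_comm]

end TreeRealization

/-! ### The Bass–Serre tree is a tree -/

section NormalForm

open Monoid Monoid.PushoutI Monoid.PushoutI.NormalWord Monoid.CoprodI

variable {ι H : Type*} {K : ι → Type*} [∀ i, Group (K i)] [Group H] {φ : ∀ i, H →* K i}
  [DecidableEq ι] [∀ i, DecidableEq (K i)] (d : Transversal φ) {i : ι} {g g' : PushoutI φ}

/-- The normal form of `g⁻¹` without its leading element of the amalgamated subgroup `H`. It depends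
only on the edge `g H` of the Bass–Serre tree, and determines it. -/
noncomputable def edgeWord (g : PushoutI φ) : Word K :=
  (g⁻¹ • (NormalWord.empty : NormalWord d)).toWord

/-- The word `edgeWord d g` without its first letter if this letter is in the `i`-th factor. It
depends only on the vertex `g Kᵢ` of the Bass–Serre tree. -/
noncomputable def vertexWord (i : ι) (g : PushoutI φ) : Word K :=
  (NormalWord.equivPair i (g⁻¹ • (NormalWord.empty : NormalWord d))).tail

variable {d}

theorem vertexWord_eq_of_inv_mul_mem_range (h : g⁻¹ * g' ∈ (PushoutI.of (φ := φ) i).range) :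
    vertexWord d i g = vertexWord d i g' := by
  obtain ⟨k, hk⟩ := h
  rw [← mul_inv_cancel_left g g', ← hk]
  unfold vertexWord
  rw [mul_inv_rev, mul_smul, ← map_inv, summand_smul_def, Equiv.apply_symm_apply]

theorem vertexWord_eq_tail (i : ι) (g : PushoutI φ) :
    vertexWord d i g = (Word.equivPair i (edgeWord d g)).tail := by
  have tail_eq : ∀ w : NormalWord d,
      (NormalWord.equivPair i w).tail = (Word.equivPair i w.toWord).tail := by
    intro w
    change (Word.equivPair i (CoprodI.of (φ i w.head) • w.toWord)).tail = _
    rw [Word.equivPair_smul_same]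
  exact tail_eq _

theorem vertexWord_eq_edgeWord (h : (edgeWord d g).fstIdx ≠ some i) :
    vertexWord d i g = edgeWord d g := by
  rw [vertexWord_eq_tail, Word.equivPair_eq_of_fstIdx_ne h]

theorem length_edgeWord (h : (edgeWord d g).fstIdx = some i) :
    (edgeWord d g).toList.length = (vertexWord d i g).toList.length + 1 := by
  have hcons := (Word.equivPair i).symm_apply_apply (edgeWord d g)
  rw [Word.equivPair_symm] at hcons
  rw [vertexWord_eq_tail]
  set p := Word.equivPair i (edgeWord d g)
  by_cases hp : p.head = 1
  · rw [Word.rcons, dif_pos hp] at hcons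
    exact absurd (hcons ▸ h) p.fstIdx_ne
  · rw [Word.rcons, dif_neg hp] at hcons
    rw [← hcons]
    rfl

theorem inv_mul_mem_range_base_of_edgeWord_eq (h : edgeWord d g = edgeWord d g') :
    g⁻¹ * g' ∈ (PushoutI.base φ).range := by
  have inv_eq : ∀ k : PushoutI φ, k⁻¹ = PushoutI.base φ
      (k⁻¹ • (NormalWord.empty : NormalWord d)).head * ofCoprodI (edgeWord d k).prod := by
    intro k
    have hprod := prod_smul k⁻¹ (NormalWord.empty : NormalWord d)
    rw [prod_empty, mul_one] at hprod
    exact hprod.symm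
  rw [← inv_inv g', inv_eq g, inv_eq g', h, mul_inv_rev, mul_assoc, mul_inv_cancel_left,
    ← map_inv, ← map_mul]
  exact ⟨_, rfl⟩

end NormalForm

section BassSerreHeight

open Monoid Monoid.PushoutI Monoid.PushoutI.NormalWord Monoid.CoprodI

variable {H : Type*} {K : Bool → Type*} [∀ i, Group (K i)] [Group H] {φ : ∀ i, H →* K i}
  [∀ i, DecidableEq (K i)] (d : Transversal φ)

/-- The distance from the vertex `g K₀` of the Bass–Serre tree to the base vertex `K₀`. -/
noncomputable def heightFst (g : PushoutI φ) : ℤ :=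
  (2 * (((vertexWord d false g).toList.length + 1) / 2) : ℕ)

/-- The distance from the vertex `g K₁` of the Bass–Serre tree to the base vertex `K₀`. -/
noncomputable def heightSnd (g : PushoutI φ) : ℤ :=
  (2 * ((vertexWord d true g).toList.length / 2) + 1 : ℕ)

variable {d}

theorem heightSnd_eq_or_heightFst_eq (g : PushoutI φ) :
    (heightSnd d g = heightFst d g + 1 ∧ vertexWord d true g = edgeWord d g) ∨
      (heightFst d g = heightSnd d g + 1 ∧ vertexWord d false g = edgeWord d g) := by
  unfold heightFst heightSnd
  rcases hidx : (edgeWord d g).fstIdx with - | - | -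
  · have hlen : (edgeWord d g).toList.length = 0 := by
      simpa [Word.fstIdx] using hidx
    have htrue : vertexWord d true g = edgeWord d g := vertexWord_eq_edgeWord (by simp [hidx])
    have hfalse : vertexWord d false g = edgeWord d g := vertexWord_eq_edgeWord (by simp [hidx])
    refine .inl ⟨?_, htrue⟩
    rw [htrue, hfalse, hlen]
    rfl
  · have htrue : vertexWord d true g = edgeWord d g := vertexWord_eq_edgeWord (by simp [hidx])
    refine .inl ⟨?_, htrue⟩
    rw [htrue, length_edgeWord hidx]
    omega
  · have hfalse : vertexWord d false g = edgeWord d g := vertexWord_eq_edgeWord (by simp [hidx])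
    refine .inr ⟨?_, hfalse⟩
    rw [hfalse, length_edgeWord hidx]
    omega

variable {A B C : Subgroup (PushoutI φ)}

variable (d) in
/-- The distance to the vertex `A`, as a height function on the Bass–Serre tree of an amalgamated
free product of `A` and `B` along `C`. -/
noncomputable def bassSerreHeight (hCA : C ≤ A) (hCB : C ≤ B)
    (hA : A ≤ (PushoutI.of (φ := φ) false).range) (hB : B ≤ (PushoutI.of (φ := φ) true).range)
    (hC : (PushoutI.base φ).range ≤ C) :
    TreeHeight (Subgroup.quotientMapOfLE hCA) (Subgroup.quotientMapOfLE hCB) where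
  hV := Quotient.lift (heightFst d) fun g g' h => by
    rw [heightFst, heightFst,
      vertexWord_eq_of_inv_mul_mem_range (hA (QuotientGroup.leftRel_apply.1 h))]
  hW := Quotient.lift (heightSnd d) fun g g' h => by
    rw [heightSnd, heightSnd,
      vertexWord_eq_of_inv_mul_mem_range (hB (QuotientGroup.leftRel_apply.1 h))]
  diff e := by
    obtain ⟨g, rfl⟩ := QuotientGroup.mk_surjective e
    exact (heightSnd_eq_or_heightFst_eq g).imp And.left And.left
  uniqV e e' hee' h h' := by
    obtain ⟨g, rfl⟩ := QuotientGroup.mk_surjective e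
    obtain ⟨g', rfl⟩ := QuotientGroup.mk_surjective e'
    have edgeWord_eq : ∀ k, heightFst d k = heightSnd d k + 1 →
        vertexWord d false k = edgeWord d k := fun k hk =>
      ((heightSnd_eq_or_heightFst_eq k).resolve_left fun hk' => by linarith [hk'.1]).2
    refine QuotientGroup.eq.2 (hC (inv_mul_mem_range_base_of_edgeWord_eq (d := d) ?_))
    rw [← edgeWord_eq g h, ← edgeWord_eq g' h']
    exact vertexWord_eq_of_inv_mul_mem_range (hA (QuotientGroup.eq.1 hee'))
  uniqW e e' hee' h h' := by
    obtain ⟨g, rfl⟩ := QuotientGroup.mk_surjective e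
    obtain ⟨g', rfl⟩ := QuotientGroup.mk_surjective e'
    have edgeWord_eq : ∀ k, heightSnd d k = heightFst d k + 1 →
        vertexWord d true k = edgeWord d k := fun k hk =>
      ((heightSnd_eq_or_heightFst_eq k).resolve_right fun hk' => by linarith [hk'.1]).2
    refine QuotientGroup.eq.2 (hC (inv_mul_mem_range_base_of_edgeWord_eq (d := d) ?_))
    rw [← edgeWord_eq g h, ← edgeWord_eq g' h']
    exact vertexWord_eq_of_inv_mul_mem_range (hB (QuotientGroup.eq.1 hee'))

end BassSerreHeight

section Amalgam

open Monoid.PushoutI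

variable {M : Type*} [Group M] (G : ℕ → Subgroup M) (n : ℕ)

theorem base_eq_inM (g : G n) : (base (G := fun _ : Bool => M) (fun _ => (G n).subtype) g) =
    inM G n g :=
  (of_apply_eq_base (ι := Bool) (G := fun _ => M) (fun _ => (G n).subtype) false g).symm

open Classical in
theorem nonempty_treeHeight : Nonempty (TreeHeight (Subgroup.quotientMapOfLE (edgeGroup_le G n))
    (Subgroup.quotientMapOfLE (edgeGroup_le' G n))) :=
  (NormalWord.transversal_nonempty _ fun _ => (G n).subtype_injective).map fun d =>
    bassSerreHeight d (edgeGroup_le G n) (edgeGroup_le' G n) le_rfl le_rfl <| by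
      rintro _ ⟨g, rfl⟩
      exact ⟨g, g.2, (base_eq_inM G n g).symm⟩

theorem inM_injective : Function.Injective (inM G n) :=
  of_injective (fun _ => (G n).subtype_injective) false

theorem inM'_injective : Function.Injective (inM' G n) :=
  of_injective (fun _ => (G n).subtype_injective) true

theorem range_inf_range_le : (inM G n).range ⊓ (inM' G n).range ≤ edgeGroup G n := by
  refine (inf_of_range_eq_base_range (fun _ => (G n).subtype_injective) Bool.false_ne_true).le.trans
    ?_
  rintro _ ⟨g, rfl⟩
  exact ⟨g, g.2, (base_eq_inM G n g).symm⟩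

variable {G n} {x : M}

theorem inM'_mem_range_inM : inM' G n x ∈ (inM G n).range ↔ x ∈ G n := by
  refine ⟨fun h => ?_, fun h => ⟨x, inM_eq_inM' G n h⟩⟩
  obtain ⟨y, hy, hyx⟩ := range_inf_range_le G n ⟨h, ⟨x, rfl⟩⟩
  rw [inM_eq_inM' G n hy] at hyx
  rwa [← inM'_injective G n hyx]

theorem inM_mem_range_inM' : inM G n x ∈ (inM' G n).range ↔ x ∈ G n := by
  refine ⟨fun h => ?_, fun h => ⟨x, (inM_eq_inM' G n h).symm⟩⟩
  obtain ⟨y, hy, hyx⟩ := range_inf_range_le G n ⟨⟨x, rfl⟩, h⟩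
  rwa [← inM_injective G n hyx]

end Amalgam

/-! ### The metric of the Bass–Serre trees -/

section BSTree

variable {M : Type*} [Group M] {G : ℕ → Subgroup M} {n : ℕ}

theorem BSTree.dist_def (x y : BSTree G n) : dist x y = 1 / 2 ^ n * simplicialDist _ _ x y := rfl

theorem BSTree.connected (x y : BSTree G n) : ∃ r, HasPath _ _ x y r :=
  CosetGraph.connected _ _ (range_sup_range G n) x y

theorem BSTree.fourPoint : FourPoint (BSTree G n) := by
  obtain ⟨H⟩ := nonempty_treeHeight G n
  intro x y z w
  simp only [BSTree.dist_def, ← mul_add]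
  rw [← mul_max_of_nonneg _ _ (by positivity)]
  exact mul_le_mul_of_nonneg_left (H.simplicialDist_fourPoint BSTree.connected x y z w)
    (by positivity)

theorem BSTree.dist_pt (e : Amalgam G n ⧸ edgeGroup G n) (s u : unitInterval) :
    dist (Realization.pt _ _ e s : BSTree G n) (Realization.pt _ _ e u) =
      1 / 2 ^ n * |(s : ℝ) - u| := by
  obtain ⟨H⟩ := nonempty_treeHeight G n
  rw [BSTree.dist_def, H.simplicialDist_pt BSTree.connected]

theorem BSTree.isometry_smul (g : Amalgam G n) : Isometry fun x : BSTree G n => g • x := by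
  have smul_le (g : Amalgam G n) (x y : BSTree G n) :
      simplicialDist _ _ (g • x) (g • y) ≤ simplicialDist _ _ x y :=
    le_csInf (BSTree.connected x y) fun r hr =>
      (CosetGraph.hasPath_smul _ _ g hr).simplicialDist_le
  refine Isometry.of_dist_eq fun x y => congrArg (1 / 2 ^ n * ·) ((smul_le g x y).antisymm ?_)
  simpa only [inv_smul_smul] using smul_le g⁻¹ (g • x) (g • y)

theorem BSTree.dist_smul (g : Amalgam G n) (x y : BSTree G n) : dist (g • x) (g • y) = dist x y :=
  (BSTree.isometry_smul g).dist_eq x y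

theorem MetricBtw.smul {x y z : BSTree G n} (h : MetricBtw x y z) (g : Amalgam G n) :
    MetricBtw (g • x) (g • y) (g • z) := by
  unfold MetricBtw at *
  rwa [BSTree.dist_smul, BSTree.dist_smul, BSTree.dist_smul]

theorem BSTree.exists_isSegment_pt (e : Amalgam G n ⧸ edgeGroup G n) (s u : unitInterval) :
    ∃ A, IsSegment A (Realization.pt _ _ e s : BSTree G n) (Realization.pt _ _ e u) ∧
      ∀ z ∈ A, ∃ v, z = Realization.pt _ _ e v := by
  wlog hsu : (s : ℝ) ≤ u generalizing s u
  · obtain ⟨A, hA, hmem⟩ := this u s (le_of_not_ge hsu)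
    exact ⟨A, hA.symm, hmem⟩
  have h2 : (0 : ℝ) < 2 ^ n := by positivity
  let param (r : ℝ) : unitInterval := Set.projIcc 0 1 zero_le_one (s + 2 ^ n * r)
  have coe_param (r : ℝ) (hr : r ∈ Set.Icc (0 : ℝ) (1 / 2 ^ n * (u - s))) :
      (param r : ℝ) = s + 2 ^ n * r := by
    have hr1 : 2 ^ n * r ≤ u - s := by
      have := mul_le_mul_of_nonneg_left hr.2 h2.le
      rwa [← mul_assoc, mul_one_div_cancel h2.ne', one_mul] at this
    have hr0 : 0 ≤ 2 ^ n * r := mul_nonneg h2.le hr.1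
    exact congrArg Subtype.val (Set.projIcc_of_mem zero_le_one
      ⟨by linarith [s.2.1], by linarith [u.2.2]⟩)
  have hlen : (0 : ℝ) ≤ 1 / 2 ^ n * (u - s) := mul_nonneg (by positivity) (sub_nonneg.2 hsu)
  refine ⟨_, ⟨fun r => Realization.pt _ _ e (param r), 1 / 2 ^ n * (u - s), ⟨hlen, ?_⟩, ?_, ?_,
    rfl⟩, ?_⟩
  · intro r hr r' hr'
    rw [BSTree.dist_pt, coe_param r hr, coe_param r' hr', add_sub_add_left_eq_sub, ← mul_sub,
      abs_mul, abs_of_pos h2, ← mul_assoc, one_div_mul_cancel h2.ne', one_mul]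
  · exact congrArg _ (Subtype.ext (by simp [coe_param 0 ⟨le_rfl, hlen⟩]))
  · refine congrArg _ (Subtype.ext ?_)
    rw [coe_param _ ⟨hlen, le_rfl⟩, ← mul_assoc, mul_one_div_cancel h2.ne']
    ring
  · rintro _ ⟨r, -, rfl⟩
    exact ⟨_, rfl⟩

/-- The points `x` and `y` lie on a common edge. -/
def OnEdge (x y : BSTree G n) : Prop :=
  ∃ e s u, x = Realization.pt _ _ e s ∧ y = Realization.pt _ _ e u

theorem isPiece_onEdge : IsPiece (OnEdge (G := G) (n := n)) where
  symm := by
    rintro _ _ ⟨e, s, u, rfl, rfl⟩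
    exact ⟨e, u, s, rfl, rfl⟩
  left := by
    rintro _ c _ ⟨e, s, u, rfl, rfl⟩ hc
    obtain ⟨A, hA, hmem⟩ := BSTree.exists_isSegment_pt e s u
    rw [BSTree.fourPoint.isSegment_eq hA] at hmem
    obtain ⟨v, rfl⟩ := hmem c hc
    exact ⟨e, s, v, rfl, rfl⟩
  segment := by
    rintro _ _ ⟨e, s, u, rfl, rfl⟩
    exact (BSTree.exists_isSegment_pt e s u).imp fun _ h => h.1

theorem BSTree.chain (x y : BSTree G n) : Chain OnEdge x y := by
  obtain ⟨_, h⟩ := BSTree.connected x y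
  induction h with
  | nil x => exact .nil x
  | cons e s u _ _ _ ih =>
    exact Chain.trans_piece BSTree.fourPoint isPiece_onEdge ⟨e, s, u, rfl, rfl⟩ ih

theorem BSTree.isRTree : IsRTree (BSTree G n) :=
  BSTree.fourPoint.isRTree fun x y => (BSTree.chain x y).exists_isSegment isPiece_onEdge.segment

end BSTree

/-! ### Words and paths of vertices -/

section Words

variable {M : Type*} [Group M] (G : ℕ → Subgroup M) (n : ℕ)

/-- The inclusions of the two factors of the amalgam, `inM` for `false` and `inM'` for `true`. -/
def factor (b : Bool) : M →* Amalgam G n :=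
  Monoid.PushoutI.of (ι := Bool) (G := fun _ => M) (φ := fun _ => (G n).subtype) b

/-- The vertices of the Bass–Serre tree: `g M` for `false` and `g M'`, where `M'` is the second copy
of `M`, for `true`. -/
def vertex (b : Bool) (g : Amalgam G n) : BSTree G n :=
  Realization.pt _ _ (g : Amalgam G n ⧸ edgeGroup G n) (bif b then 1 else 0)

/-- The last vertex of the path which starts at the vertex of type `b` of the base edge and whose
successive edges are chosen by the letters of the word. The letter `m` acts through the factor which
stabilizes the current vertex of the path, so the types of the factors alternate. -/
def wordVertex : Bool → List M → BSTree G n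
  | b, [] => vertex G n b 1
  | b, m :: l => factor G n b m • wordVertex (!b) l

variable {G n} {b : Bool} {g g' : Amalgam G n} {l l₁ l₂ : List M} {m x c : M}

theorem factor_false : factor G n false = inM G n := rfl

theorem factor_true : factor G n true = inM' G n := rfl

theorem factor_eq_factor_not (hx : x ∈ G n) (b : Bool) : factor G n b x = factor G n (!b) x := by
  cases b
  · exact inM_eq_inM' G n hx
  · exact (inM_eq_inM' G n hx).symm

theorem factor_mem_range_factor_not : factor G n (!b) x ∈ (factor G n b).range ↔ x ∈ G n := by
  cases b
  · exact inM'_mem_range_inM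
  · exact inM_mem_range_inM'

theorem smul_vertex (g g' : Amalgam G n) (b : Bool) :
    g • vertex G n b g' = vertex G n b (g * g') := rfl

theorem vertex_eq_vertex_iff : vertex G n b g = vertex G n b g' ↔
    g⁻¹ * g' ∈ (factor G n b).range := by
  cases b
  · exact Realization.pt_zero_eq_pt_zero_iff.trans QuotientGroup.eq
  · exact Realization.pt_one_eq_pt_one_iff.trans QuotientGroup.eq

theorem vertex_mul_factor (b : Bool) (g : Amalgam G n) (m : M) :
    vertex G n b (g * factor G n b m) = vertex G n b g :=
  (vertex_eq_vertex_iff.2 ⟨m, (inv_mul_cancel_left g _).symm⟩).symm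

theorem factor_smul_vertex_one (b : Bool) (m : M) :
    factor G n b m • vertex G n b 1 = vertex G n b 1 := by
  rw [smul_vertex, mul_one, ← one_mul (factor G n b m), vertex_mul_factor]

theorem dist_vertex_vertex_not (b : Bool) (g : Amalgam G n) :
    dist (vertex G n b g) (vertex G n (!b) g) = 1 / 2 ^ n := by
  cases b <;> simp [vertex, BSTree.dist_pt]

theorem dist_vertex_false_true (g : Amalgam G n) :
    dist (vertex G n false g) (vertex G n true g) = 1 / 2 ^ n :=
  dist_vertex_vertex_not false g

theorem vertex_ne_vertex_not (b : Bool) (g : Amalgam G n) :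
    vertex G n b g ≠ vertex G n (!b) g := by
  rw [← dist_pos, dist_vertex_vertex_not]
  positivity

theorem two_div_le_dist_vertex (h : vertex G n b g ≠ vertex G n b g') :
    2 * (1 / 2 ^ n) ≤ dist (vertex G n b g) (vertex G n b g') := by
  rw [BSTree.dist_def, mul_comm]
  refine mul_le_mul_of_nonneg_left ?_ (by positivity)
  cases b
  · exact two_le_simplicialDist_pt_zero BSTree.connected
      (mt Realization.pt_zero_eq_pt_zero_iff.2 h)
  · exact two_le_simplicialDist_pt_one BSTree.connected
      (mt Realization.pt_one_eq_pt_one_iff.2 h)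

theorem metricBtw_vertex (b : Bool) (hx : x ∉ G n) :
    MetricBtw (vertex G n b 1) (vertex G n (!b) 1) (vertex G n b (factor G n (!b) x)) := by
  have h2 : dist (vertex G n (!b) 1) (vertex G n b (factor G n (!b) x)) = 1 / 2 ^ n := by
    rw [← factor_smul_vertex_one (!b) x, smul_vertex, mul_one, dist_comm, dist_vertex_vertex_not]
  have hne : vertex G n b 1 ≠ vertex G n b (factor G n (!b) x) := by
    rwa [Ne, vertex_eq_vertex_iff, inv_one, one_mul, factor_mem_range_factor_not]
  refine le_antisymm ?_ (dist_triangle _ _ _)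
  rw [dist_vertex_vertex_not, h2, ← two_mul]
  exact two_div_le_dist_vertex hne

theorem metricBtw_wordVertex (b : Bool) (hl : ∀ x ∈ l, x ∉ G n) :
    MetricBtw (vertex G n b 1) (vertex G n (!b) 1) (wordVertex G n (!b) l) := by
  induction l generalizing b with
  | nil => exact metricBtw_right _ _
  | cons x l ih =>
    obtain ⟨hx, hl⟩ := List.forall_mem_cons.1 hl
    have hturn := metricBtw_vertex b hx
    have hrest := (ih (!b) hl).smul (factor G n (!b) x)
    rw [factor_smul_vertex_one, Bool.not_not, smul_vertex, mul_one] at hrest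
    have hne : vertex G n (!b) 1 ≠ vertex G n b (factor G n (!b) x) := by
      rw [← factor_smul_vertex_one (!b) x, smul_vertex, mul_one]
      exact (vertex_ne_vertex_not b _).symm
    rw [wordVertex, Bool.not_not]
    exact (BSTree.fourPoint.metricBtw_trans hturn hrest hne).trans_left hturn

theorem dist_wordVertex (b : Bool) (hl : ∀ x ∈ l.tail, x ∉ G n) :
    dist (vertex G n b 1) (wordVertex G n b l) = l.length / 2 ^ n := by
  induction l generalizing b with
  | nil => simp [wordVertex]
  | cons x l ih =>
    have h : dist _ _ + dist _ _ = dist _ _ := metricBtw_wordVertex (l := l) b hl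
    rw [wordVertex, ← factor_smul_vertex_one b x, BSTree.dist_smul, ← h, dist_vertex_vertex_not,
      ih (!b) fun y hy => hl y (List.mem_of_mem_tail hy), List.length_cons]
    push_cast
    ring

theorem wordVertex_replicate (m : M) (k : ℕ) : wordVertex G n false (List.replicate (2 * k) m) =
    (inM G n m * inM' G n m) ^ k • vertex G n false 1 := by
  induction k with
  | zero => rw [pow_zero, one_smul]; rfl
  | succ k ih => rw [pow_succ', mul_smul, ← ih, mul_smul]; rfl

theorem factor_smul_wordVertex (b : Bool) (m : M) (l : List M) :
    factor G n b m • wordVertex G n b l = wordVertex G n b (l.modifyHead (m * ·)) := by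
  cases l with
  | nil => exact factor_smul_vertex_one b m
  | cons x l => rw [List.modifyHead_cons, wordVertex, wordVertex, map_mul, mul_smul]

theorem exists_smul_wordVertex_eq (g : Amalgam G n) (l : List M) :
    ∃ l', g • wordVertex G n false l = wordVertex G n false l' := by
  induction g using Monoid.PushoutI.induction_on generalizing l with
  | of i m =>
    cases i
    · exact ⟨_, factor_smul_wordVertex false m l⟩
    · refine ⟨1 :: m :: l, ?_⟩
      rw [wordVertex, map_one, one_smul]
      rfl
  | base m =>
    exact ⟨l.modifyHead ((m : M) * ·), base_eq_inM G n m ▸ factor_smul_wordVertex false (m : M) l⟩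
  | mul g g' hg hg' =>
    obtain ⟨l', hl'⟩ := hg' l
    rw [mul_smul, hl']
    exact hg l'

theorem exists_wordVertex_eq_vertex (b : Bool) (g : Amalgam G n) :
    ∃ l, wordVertex G n false l = vertex G n b g := by
  have hone : ∃ l, wordVertex G n false l = vertex G n b 1 := by
    cases b
    · exact ⟨[], rfl⟩
    · exact ⟨[1], by rw [wordVertex, map_one, one_smul]; rfl⟩
  obtain ⟨l, hl⟩ := hone
  obtain ⟨l', hl'⟩ := exists_smul_wordVertex_eq g l
  exact ⟨l', by rw [← hl', hl, smul_vertex, mul_one]⟩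

theorem wordVertex_append_congr (h : ∀ b, wordVertex G n b l₁ = wordVertex G n b l₂) (l : List M)
    (b : Bool) : wordVertex G n b (l ++ l₁) = wordVertex G n b (l ++ l₂) := by
  induction l generalizing b with
  | nil => exact h b
  | cons x l ih => rw [List.cons_append, List.cons_append, wordVertex, wordVertex, ih]

/-- A letter of the amalgamated subgroup belongs to both factors, so that it merges with its two
neighbours. -/
theorem wordVertex_merge (hc : c ∈ G n) (l₁ l₂ : List M) (x : M) (b : Bool) :
    wordVertex G n b (l₁ ++ x :: c :: l₂) =
      wordVertex G n b (l₁ ++ l₂.modifyHead (x * c * ·)) := by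
  refine wordVertex_append_congr (fun b => ?_) l₁ b
  rw [wordVertex, wordVertex, Bool.not_not, ← factor_eq_factor_not hc, ← mul_smul, ← map_mul,
    factor_smul_wordVertex]

end Words

/-! ### Sequences of metric spaces -/

section Seq

theorem seqMap_succ_left {X : ℕ → Type*} (f : ∀ n, X n → X (n + 1)) {l j : ℕ} (h : l + 1 ≤ j)
    (x : X l) : seqMap f h (f l x) = seqMap f ((Nat.le_succ l).trans h) x :=
  Nat.leRecOn_succ_left x ((Nat.le_succ l).trans h) h

theorem seqMap_trans {X : ℕ → Type*} (f : ∀ n, X n → X (n + 1)) {l k j : ℕ} (h : l ≤ k)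
    (h' : k ≤ j) (x : X l) : seqMap f h' (seqMap f h x) = seqMap f (h.trans h') x :=
  (Nat.leRecOn_trans h h' x).symm

theorem seqMap_surjective {X : ℕ → Type*} {f : ∀ n, X n → X (n + 1)}
    (hs : ∀ n, Function.Surjective (f n)) {l j : ℕ} (h : l ≤ j) :
    Function.Surjective (seqMap f h) := by
  induction j, h using Nat.le_induction with
  | base => exact fun x => ⟨x, seqMap_self f x⟩
  | succ j h ih =>
    intro x
    obtain ⟨y, rfl⟩ := hs j x
    obtain ⟨z, rfl⟩ := ih y
    exact ⟨z, seqMap_succ f h z⟩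

variable {X : ℕ → Type*} [∀ n, MetricSpace (X n)] (f : ∀ n, X n → X (n + 1))

/-- All maps of the sequence preserve the distance of the images of `x` and `y`. -/
def PermIso {l : ℕ} (x y : X l) : Prop :=
  ∀ (j : ℕ) (h : l ≤ j), dist (seqMap f h x) (seqMap f h y) = dist x y

/-- From the index `k` on, the distance of the images of `x` and `y` is constant. -/
def StableFrom {l : ℕ} (k : ℕ) (x y : X l) : Prop :=
  ∃ hk : l ≤ k, PermIso f (seqMap f hk x) (seqMap f hk y)

/-- The distance of the images of `x` and `y` is eventually constant. -/
def EventuallyStable {l : ℕ} (x y : X l) : Prop := ∃ k, StableFrom f k x y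

variable {f} {l k k' j : ℕ} {s v v' w x y z : X l}

theorem PermIso.symm (h : PermIso f x y) : PermIso f y x := by
  intro j hj
  rw [dist_comm, h j hj, dist_comm]

theorem PermIso.map_seqMap (h : PermIso f x y) (hj : l ≤ j) :
    PermIso f (seqMap f hj x) (seqMap f hj y) := by
  intro i hi
  rw [seqMap_trans, seqMap_trans, h i, h j]

theorem PermIso.of_map (h : PermIso f (f l x) (f l y)) (h' : dist (f l x) (f l y) = dist x y) :
    PermIso f x y := by
  intro j hj
  rcases hj.eq_or_lt with rfl | hj
  · simp only [seqMap_self]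
  · rw [← seqMap_succ_left f hj, ← seqMap_succ_left f hj, h j hj, h']

theorem PermIso.eventuallyStable (h : PermIso f x y) : EventuallyStable f x y :=
  ⟨l, le_rfl, h.map_seqMap le_rfl⟩

theorem StableFrom.symm (h : StableFrom f k x y) : StableFrom f k y x :=
  h.imp fun _ h => h.symm

theorem StableFrom.mono (h : StableFrom f k x y) (hk : k ≤ k') : StableFrom f k' x y := by
  obtain ⟨hlk, h⟩ := h
  refine ⟨hlk.trans hk, ?_⟩
  rw [← seqMap_trans f hlk hk, ← seqMap_trans f hlk hk]
  exact h.map_seqMap hk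

theorem EventuallyStable.symm (h : EventuallyStable f x y) : EventuallyStable f y x :=
  h.imp fun _ h => h.symm

theorem EventuallyStable.of_seqMap (hj : l ≤ j)
    (h : EventuallyStable f (seqMap f hj x) (seqMap f hj y)) : EventuallyStable f x y := by
  obtain ⟨k, hk, h⟩ := h
  rw [seqMap_trans, seqMap_trans] at h
  exact ⟨k, hj.trans hk, h⟩

theorem EventuallyStable.of_map (h : EventuallyStable f (f l x) (f l y)) :
    EventuallyStable f x y := by
  have seqMap_one (z : X l) : seqMap f (Nat.le_succ l) z = f l z := by
    rw [← seqMap_succ_left f le_rfl, seqMap_self]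
  refine .of_seqMap (Nat.le_succ l) ?_
  rwa [seqMap_one, seqMap_one]

theorem lipschitz_seqMap (hf : ∀ n, LipschitzWith 1 (f n)) (h : l ≤ j) (x y : X l) :
    dist (seqMap f h x) (seqMap f h y) ≤ dist x y := by
  induction j, h using Nat.le_induction with
  | base => simp only [seqMap_self, le_refl]
  | succ j h ih =>
    rw [seqMap_succ f h, seqMap_succ f h]
    simpa only [NNReal.coe_one, one_mul] using ((hf j).dist_le_mul _ _).trans (by simpa using ih)

theorem PermIso.metricBtw (hf : ∀ n, LipschitzWith 1 (f n)) (h : PermIso f x z)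
    (hb : MetricBtw x y z) : PermIso f x y ∧ PermIso f y z ∧
      ∀ (j : ℕ) (hj : l ≤ j), MetricBtw (seqMap f hj x) (seqMap f hj y) (seqMap f hj z) := by
  have dist_eq (j : ℕ) (hj : l ≤ j) : dist (seqMap f hj x) (seqMap f hj y) = dist x y ∧
      dist (seqMap f hj y) (seqMap f hj z) = dist y z := by
    have h1 := lipschitz_seqMap hf hj x y
    have h2 := lipschitz_seqMap hf hj y z
    have h3 := dist_triangle (seqMap f hj x) (seqMap f hj y) (seqMap f hj z)
    rw [h j hj, ← hb] at h3
    constructor <;> linarith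
  refine ⟨fun j hj => (dist_eq j hj).1, fun j hj => (dist_eq j hj).2, fun j hj => ?_⟩
  unfold MetricBtw
  rw [(dist_eq j hj).1, (dist_eq j hj).2, h j hj, hb]

theorem PermIso.of_metricBtw (hX : ∀ n, FourPoint (X n)) (hf : ∀ n, LipschitzWith 1 (f n))
    (h : PermIso f v v') (hb : MetricBtw v w v') (hv : PermIso f s v) (hv' : PermIso f s v') :
    PermIso f s w := by
  obtain ⟨hvw, hwv', hb'⟩ := h.metricBtw hf hb
  intro j hj
  rw [(hX j).dist_eq_max _ (hb' j hj), (hX l).dist_eq_max _ hb, hv j hj, hv' j hj, hvw j hj,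
    hwv' j hj]

theorem StableFrom.of_metricBtw (hX : ∀ n, FourPoint (X n)) (hf : ∀ n, LipschitzWith 1 (f n))
    (h : PermIso f v v') (hb : MetricBtw v w v') (hv : StableFrom f k s v)
    (hv' : StableFrom f k s v') : StableFrom f k s w := by
  obtain ⟨hk, hv⟩ := hv
  obtain ⟨_, hv'⟩ := hv'
  exact ⟨hk, (h.map_seqMap hk).of_metricBtw hX hf ((h.metricBtw hf hb).2.2 k hk) hv hv'⟩

theorem EventuallyStable.of_metricBtw (hX : ∀ n, FourPoint (X n))
    (hf : ∀ n, LipschitzWith 1 (f n)) (h : PermIso f v v') (hb : MetricBtw v w v')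
    (hv : EventuallyStable f s v) (hv' : EventuallyStable f s v') : EventuallyStable f s w := by
  obtain ⟨k, hk⟩ := hv
  obtain ⟨k', hk'⟩ := hv'
  exact ⟨max k k', .of_metricBtw hX hf h hb (hk.mono (le_max_left _ _))
    (hk'.mono (le_max_right _ _))⟩

theorem convergesStrongly_of_chain (hX : ∀ n, FourPoint (X n))
    (hf : ∀ n, LipschitzWith 1 (f n)) (hs : ∀ (l : ℕ) (x y : X l), EventuallyStable f x y)
    (hc : ∀ (l : ℕ) (x y : X l), Chain (PermIso f) x y) : ConvergesStrongly f := by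
  intro l x y
  have stable_right (s : X l) : ∃ k, ∀ t, MetricBtw x t y → StableFrom f k s t :=
    (hc l x y).exists_forall_of_forall_exists (hX l) (fun _ _ hk _ h => h.mono hk) (hs l s)
      fun _ _ _ _ hR hb hu hv => .of_metricBtw hX hf hR hb hu hv
  obtain ⟨k, hk⟩ : ∃ k, ∀ s, MetricBtw x s y → ∀ t, MetricBtw x t y → StableFrom f k s t :=
    (hc l x y).exists_forall_of_forall_exists (hX l) (fun _ _ hk _ h t ht => (h t ht).mono hk)
      stable_right fun _ _ _ _ hR hb hu hv t ht =>
        (StableFrom.of_metricBtw hX hf hR hb (hu t ht).symm (hv t ht).symm).symm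
  obtain ⟨hlk, -⟩ := hk x (metricBtw_left x y) x (metricBtw_left x y)
  refine ⟨k, hlk, fun A hA s hsA t htA j hj => ?_⟩
  rw [(hX l).isSegment_eq hA] at hsA htA
  rw [← seqMap_trans f hlk hj, ← seqMap_trans f hlk hj, (hk s hsA t htA).2 j hj]

end Seq

/-! ### The limit space -/

section Limit

variable {X : ℕ → Type*} [∀ n, MetricSpace (X n)] {f : ∀ n, X n → X (n + 1)}
  (hf : ∀ n, LipschitzWith 1 (f n)) {k : ℕ} {x y : X 0}

theorem dist_toLimit (x y : X 0) : dist (toLimit f hf x) (toLimit f hf y) = limDist f x y := rfl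

theorem toLimit_surjective : Function.Surjective (toLimit f hf) :=
  SeparationQuotient.surjective_mk (X := LimitPre f hf)

theorem fourPoint_limitSpace (hX : ∀ n, FourPoint (X n)) : FourPoint (LimitSpace f hf) := by
  intro x y z w
  obtain ⟨x, rfl⟩ := toLimit_surjective hf x
  obtain ⟨y, rfl⟩ := toLimit_surjective hf y
  obtain ⟨z, rfl⟩ := toLimit_surjective hf z
  obtain ⟨w, rfl⟩ := toLimit_surjective hf w
  simp only [dist_toLimit]
  exact le_of_tendsto_of_tendsto' ((tendsto_limDist f hf x y).add (tendsto_limDist f hf z w))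
    (((tendsto_limDist f hf x z).add (tendsto_limDist f hf y w)).max
      ((tendsto_limDist f hf x w).add (tendsto_limDist f hf y z)))
    fun n => hX n _ _ _ _

theorem StableFrom.dist_toLimit (h : StableFrom f k x y) :
    dist (toLimit f hf x) (toLimit f hf y) =
      dist (seqMap f (Nat.zero_le k) x) (seqMap f (Nat.zero_le k) y) := by
  refine tendsto_nhds_unique (tendsto_limDist f hf x y)
    (tendsto_atTop_of_eventually_const (i₀ := k) fun j hj => ?_)
  rw [← seqMap_trans f (Nat.zero_le k) hj, ← seqMap_trans f (Nat.zero_le k) hj, h.2 j hj]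

theorem StableFrom.metricBtw_toLimit {w : X 0} (h : StableFrom f k x y)
    (hb : MetricBtw (seqMap f (Nat.zero_le k) x) (seqMap f (Nat.zero_le k) w)
      (seqMap f (Nat.zero_le k) y)) :
    MetricBtw (toLimit f hf x) (toLimit f hf w) (toLimit f hf y) := by
  obtain ⟨hxw, hwy, -⟩ := h.2.metricBtw hf hb
  have hxw : StableFrom f k x w := ⟨Nat.zero_le k, hxw⟩
  have hwy : StableFrom f k w y := ⟨Nat.zero_le k, hwy⟩
  unfold MetricBtw
  rwa [h.dist_toLimit hf, hxw.dist_toLimit hf, hwy.dist_toLimit hf]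

theorem toLimit_eq_of_seqMap_eq
    (h : seqMap f (Nat.zero_le k) x = seqMap f (Nat.zero_le k) y) :
    toLimit f hf x = toLimit f hf y := by
  have hst : StableFrom f k x y := ⟨Nat.zero_le k, fun j hj => by rw [h, dist_self, dist_self]⟩
  rw [← dist_eq_zero, hst.dist_toLimit hf, h, dist_self]

theorem EventuallyStable.exists_seqMap_eq_of_toLimit_eq (hs : EventuallyStable f x y)
    (h : toLimit f hf x = toLimit f hf y) :
    ∃ k, ∀ j, k ≤ j → seqMap f (Nat.zero_le j) x = seqMap f (Nat.zero_le j) y := by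
  obtain ⟨k, hk⟩ := hs
  refine ⟨k, fun j hj => dist_eq_zero.1 ?_⟩
  rw [← (hk.mono hj).dist_toLimit hf, h, dist_self]

theorem StableFrom.exists_isSegment (hs : ∀ n, Function.Surjective (f n)) (h : StableFrom f k x y)
    (hseg : ∃ A, IsSegment A (seqMap f (Nat.zero_le k) x) (seqMap f (Nat.zero_le k) y)) :
    ∃ A, IsSegment A (toLimit f hf x) (toLimit f hf y) := by
  obtain ⟨_, γ, ℓ, hγ, h0, hℓ, -⟩ := hseg
  obtain ⟨hk, hxy⟩ := h
  rw [← h0, ← hℓ] at hxy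
  choose lift hlift using fun z => seqMap_surjective hs hk z
  have dist_lift {r t : ℝ} (hr : r ∈ Set.Icc 0 ℓ) (ht : t ∈ Set.Icc 0 ℓ) (hrt : r ≤ t) :
      dist (toLimit f hf (lift (γ r))) (toLimit f hf (lift (γ t))) = |r - t| := by
    have hb : MetricBtw (γ 0) (γ r) (γ t) := by
      unfold MetricBtw
      rw [hγ.dist_zero hr, hγ.dist_zero ht, hγ.dist_of_le hr.1 hrt ht.2]
      ring
    have hst : StableFrom f k (lift (γ r)) (lift (γ t)) := by
      refine ⟨hk, ?_⟩
      rw [hlift, hlift]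
      exact ((hxy.metricBtw hf (hγ.metricBtw ht)).1.metricBtw hf hb).2.1
    rw [hst.dist_toLimit hf, hlift, hlift, hγ.2 r hr t ht]
  refine ⟨_, fun t => toLimit f hf (lift (γ t)), ℓ, ⟨hγ.1, fun r hr t ht => ?_⟩, ?_, ?_, rfl⟩
  · rcases le_total r t with hrt | hrt
    · exact dist_lift hr ht hrt
    · rw [dist_comm, dist_lift ht hr hrt, abs_sub_comm]
  · exact toLimit_eq_of_seqMap_eq hf ((hlift _).trans h0)
  · exact toLimit_eq_of_seqMap_eq hf ((hlift _).trans hℓ)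

end Limit

/-! ### The folding maps -/

section Fold

variable {M : Type*} [Group M] {G : ℕ → Subgroup M} {a : ℕ → M} (hG : Monotone G)
  (h1 : CondP1 G a)

theorem phi_surjective (h2 : CondP2 G a) (n : ℕ) : Function.Surjective (phi G a hG h1 n) := by
  rw [← MonoidHom.range_eq_top, ← top_le_iff, ← range_sup_range G (n + 1)]
  have hM : (inM G (n + 1)).range ≤ (phi G a hG h1 n).range := by
    rintro _ ⟨m, rfl⟩
    exact ⟨inM G n m, phi_inM G a hG h1 n m⟩
  refine sup_le hM ?_
  rw [MonoidHom.range_eq_map, Subgroup.map_le_iff_le_comap, ← h2 n]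
  refine sup_le (fun g hg => ?_) ?_
  · rw [Subgroup.mem_comap, ← inM_eq_inM' G (n + 1) hg]
    exact hM ⟨g, rfl⟩
  · rintro _ ⟨g, hg, rfl⟩
    refine ⟨inM' G n g, ?_⟩
    rw [phi_inM', inM_eq_inM' G (n + 1) hg]
    simp only [MulEquiv.toMonoidHom_eq_coe, MonoidHom.coe_coe, MulAut.conj_apply, map_mul, map_inv]

theorem foldMap_smul (n : ℕ) (g : Amalgam G n) (x : BSTree G n) :
    foldMap G a hG h1 n (g • x) = phi G a hG h1 n g • foldMap G a hG h1 n x := by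
  obtain ⟨⟨e, s⟩, rfl⟩ := Quotient.exists_rep x
  obtain ⟨k, rfl⟩ := QuotientGroup.mk_surjective e
  have firstHalf_smul : firstHalf G a hG h1 n (g • (k : Amalgam G n ⧸ edgeGroup G n))
      = phi G a hG h1 n g • firstHalf G a hG h1 n (k : Amalgam G n ⧸ edgeGroup G n) :=
    congrArg QuotientGroup.mk (map_mul (phi G a hG h1 n) g k)
  have secondHalf_smul : secondHalf G a hG h1 n (g • (k : Amalgam G n ⧸ edgeGroup G n))
      = phi G a hG h1 n g • secondHalf G a hG h1 n (k : Amalgam G n ⧸ edgeGroup G n) := by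
    refine congrArg QuotientGroup.mk ?_
    beta_reduce
    rw [smul_eq_mul, map_mul, mul_assoc]
    rfl
  change foldEdge G a hG h1 n (g • (k : Amalgam G n ⧸ edgeGroup G n)) s
    = _ • foldEdge G a hG h1 n (k : Amalgam G n ⧸ edgeGroup G n) s
  unfold foldEdge
  rw [firstHalf_smul, secondHalf_smul]
  split_ifs <;> rfl

theorem foldMap_surjective (h2 : CondP2 G a) (n : ℕ) :
    Function.Surjective (foldMap G a hG h1 n) := by
  intro x
  obtain ⟨⟨e, s⟩, rfl⟩ := Quotient.exists_rep x
  obtain ⟨k, rfl⟩ := QuotientGroup.mk_surjective e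
  obtain ⟨g, rfl⟩ := phi_surjective hG h1 h2 n k
  have hs : (s : ℝ) / 2 ≤ 1 / 2 := div_le_div_of_nonneg_right s.2.2 two_pos.le
  refine ⟨Realization.pt _ _ (g : Amalgam G n ⧸ edgeGroup G n)
    ⟨(s : ℝ) / 2, by linarith [s.2.1], by linarith⟩, ?_⟩
  rw [foldMap_pt, foldEdge, if_pos hs]
  simp only [mul_div_cancel₀ (s : ℝ) two_ne_zero, Set.projIcc_val]
  rfl

theorem foldMap_vertex_false (n : ℕ) (g : Amalgam G n) :
    foldMap G a hG h1 n (vertex G n false g) = vertex G (n + 1) false (phi G a hG h1 n g) := by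
  rw [vertex, cond_false, foldMap_pt, foldEdge, if_pos (by simp)]
  simp only [Set.Icc.coe_zero, mul_zero, Set.projIcc_left]
  rfl

theorem foldMap_vertex_true (n : ℕ) (g : Amalgam G n) :
    foldMap G a hG h1 n (vertex G n true g) =
      vertex G (n + 1) false (phi G a hG h1 n g * inM' G (n + 1) (a (n + 1))) := by
  rw [vertex, cond_true, foldMap_pt, foldEdge, if_neg (by norm_num)]
  simp only [Set.Icc.coe_one, mul_one, sub_self, Set.projIcc_left]
  rfl

theorem phiLE_self {l : ℕ} (g : Amalgam G l) : phiLE G a hG h1 l l le_rfl g = g :=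
  seqMap_self (fun n => phi G a hG h1 n) g

theorem phiLE_succ {l j : ℕ} (h : l ≤ j) (g : Amalgam G l) :
    phiLE G a hG h1 l (j + 1) (Nat.le_succ_of_le h) g = phi G a hG h1 j (phiLE G a hG h1 l j h g) :=
  seqMap_succ (fun n => phi G a hG h1 n) h g

theorem phiLE_succ_left {l j : ℕ} (h : l + 1 ≤ j) (g : Amalgam G l) :
    phiLE G a hG h1 (l + 1) j h (phi G a hG h1 l g)
      = phiLE G a hG h1 l j ((Nat.le_succ l).trans h) g :=
  seqMap_succ_left (fun n => phi G a hG h1 n) h g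

theorem phiLE_inM {l j : ℕ} (h : l ≤ j) (m : M) :
    phiLE G a hG h1 l j h (inM G l m) = inM G j m := by
  induction j, h using Nat.le_induction with
  | base => exact phiLE_self hG h1 _
  | succ j h ih => rw [phiLE_succ hG h1 h, ih, phi_inM]

theorem seqMap_smul {l j : ℕ} (h : l ≤ j) (g : Amalgam G l) (x : BSTree G l) :
    seqMap (foldMap G a hG h1) h (g • x)
      = phiLE G a hG h1 l j h g • seqMap (foldMap G a hG h1) h x := by
  induction j, h using Nat.le_induction with
  | base => rw [seqMap_self, seqMap_self, phiLE_self]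
  | succ j h ih => rw [seqMap_succ _ h, seqMap_succ _ h, ih, foldMap_smul, phiLE_succ hG h1 h]

theorem seqMap_vertex_false {l j : ℕ} (h : l ≤ j) (g : Amalgam G l) :
    seqMap (foldMap G a hG h1) h (vertex G l false g) =
      vertex G j false (phiLE G a hG h1 l j h g) := by
  induction j, h using Nat.le_induction with
  | base => rw [seqMap_self, phiLE_self]
  | succ j h ih => rw [seqMap_succ _ h, ih, foldMap_vertex_false, phiLE_succ hG h1 h]

end Fold

/-! ### Folding of words -/

section FoldWord

variable {M : Type*} [Group M]

/-- Words describe paths of vertices, see `wordVertex`. Folding replaces each edge of such a path by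
two edges, which inserts the letters `a` and `a⁻¹` in alternation. -/
def subdivide : M → List M → List M
  | _, [] => []
  | a, x :: l => x :: a :: subdivide a⁻¹ l

open Classical in
/-- The number of letters in the union of the subgroups `G k`. It is the complexity of a path in the
proof that distances stabilize: folding preserves it until a letter can be absorbed. -/
noncomputable def unionCount (G : ℕ → Subgroup M) (l : List M) : ℕ :=
  l.countP (· ∈ ⨆ k, G k)

/-- The form in which condition (P4) enters the proof: the conjugates of `c ∈ G i \ G (i - 1)` by
`a i` and by its inverse lie in none of the subgroups, for `i ≥ 1`. -/
def EscapesUnion (G : ℕ → Subgroup M) (a : ℕ → M) : Prop :=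
  ∀ i : ℕ, ∀ c ∈ G (i + 1), c ∉ G i → a (i + 1) * c * (a (i + 1))⁻¹ ∉ ⨆ k, G k ∧
    (a (i + 1))⁻¹ * c * a (i + 1) ∉ ⨆ k, G k

variable {G : ℕ → Subgroup M} {a : ℕ → M} {n : ℕ} {l l₁ l₂ : List M} {c x y : M}

theorem CondP4.escapesUnion (hG : Monotone G) (h4 : CondP4 G a) : EscapesUnion G a := by
  have sup_conj_le (i : ℕ) {x : M} (hx : x ∈ ⨆ k, G k) :
      ∃ n, G (i + 1) ⊔ conjSubgroup x (G (i + 1)) ≤ conjSubgroup 1 (G n) := by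
    obtain ⟨k, hk⟩ := (Subgroup.mem_iSup_of_directed hG.directed_le).1 hx
    have hi : G (i + 1) ≤ G (max k (i + 1)) := hG (le_max_right _ _)
    have hx' : x ∈ G (max k (i + 1)) := hG (le_max_left _ _) hk
    have conj_one : conjSubgroup 1 (G (max k (i + 1))) = G (max k (i + 1)) := by
      ext y
      simp [conjSubgroup]
    refine ⟨max k (i + 1), ?_⟩
    rw [conj_one]
    refine sup_le hi ?_
    rintro _ ⟨g, hg, rfl⟩
    exact mul_mem (mul_mem hx' (hi hg)) (inv_mem hx')
  refine fun i c hc hc' => ⟨fun h => ?_, fun h => ?_⟩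
  · obtain ⟨n, hn⟩ := sup_conj_le i h
    exact (h4 i c hc hc' n 1).1 hn
  · obtain ⟨n, hn⟩ := sup_conj_le i h
    exact (h4 i c hc hc' n 1).2 hn

theorem EscapesUnion.notMem (h4 : EscapesUnion G a) (hG : StrictMono G) (i : ℕ) :
    a (i + 1) ∉ ⨆ k, G k := by
  intro ha
  obtain ⟨c, hc, hc'⟩ := SetLike.exists_of_lt (hG i.lt_succ_self)
  exact (h4 i c hc hc').1 (mul_mem (mul_mem ha (Subgroup.mem_iSup_of_mem _ hc)) (inv_mem ha))

theorem exists_mem_succ_notMem (hG : Monotone G) (hc : c ∈ ⨆ k, G k) (hn : c ∉ G n) :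
    ∃ k, n ≤ k ∧ c ∈ G (k + 1) ∧ c ∉ G k := by
  classical
  have h := (Subgroup.mem_iSup_of_directed hG.directed_le).1 hc
  have hlt : n < Nat.find h := lt_of_not_ge fun hle => hn (hG hle (Nat.find_spec h))
  obtain ⟨k, hk⟩ := Nat.exists_eq_succ_of_ne_zero (Nat.ne_zero_of_lt hlt)
  exact ⟨k, by omega, hk.subst (motive := (c ∈ G ·)) (Nat.find_spec h), Nat.find_min h (by omega)⟩

theorem length_subdivide (a : M) (l : List M) : (subdivide a l).length = 2 * l.length := by
  induction l generalizing a with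
  | nil => rfl
  | cons x l ih =>
    rw [subdivide, List.length_cons, List.length_cons, ih, List.length_cons]
    ring

theorem mem_subdivide_iff {a : M} (hx : x ≠ a) (hx' : x ≠ a⁻¹) : x ∈ subdivide a l ↔ x ∈ l := by
  induction l generalizing a with
  | nil => rfl
  | cons y l ih => rw [subdivide, List.mem_cons, List.mem_cons, List.mem_cons,
      ih hx' (by rwa [inv_inv]), or_iff_right hx]

theorem mem_tail_subdivide_iff {a : M} (ha : a ∉ ⨆ k, G k) (hx : x ∈ ⨆ k, G k) :
    x ∈ (subdivide a l).tail ↔ x ∈ l.tail := by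
  have hxa : x ≠ a := fun h => ha (h ▸ hx)
  have hxa' : x ≠ a⁻¹ := fun h => ha (inv_mem_iff.1 (h ▸ hx))
  cases l with
  | nil => rfl
  | cons y l => rw [subdivide, List.tail_cons, List.tail_cons, List.mem_cons, or_iff_right hxa,
      mem_subdivide_iff hxa' (by rwa [inv_inv])]

theorem exists_subdivide_append (a : M) (l₁ : List M) : ∃ b, (b = a ∨ b = a⁻¹) ∧
    ∀ l₂, subdivide a (l₁ ++ l₂) = subdivide a l₁ ++ subdivide b l₂ := by
  induction l₁ generalizing a with
  | nil => exact ⟨a, .inl rfl, fun _ => rfl⟩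
  | cons x l₁ ih =>
    obtain ⟨b, hb, happ⟩ := ih a⁻¹
    rw [inv_inv, or_comm] at hb
    exact ⟨b, hb, fun l₂ => by rw [List.cons_append, subdivide, subdivide, happ]; rfl⟩

theorem unionCount_append (l₁ l₂ : List M) :
    unionCount G (l₁ ++ l₂) = unionCount G l₁ + unionCount G l₂ := List.countP_append

theorem unionCount_cons_le (x : M) (l : List M) : unionCount G (x :: l) ≤ unionCount G l + 1 := by
  classical
  rw [unionCount, List.countP_cons]
  split_ifs <;> simp [unionCount]

theorem unionCount_le_cons (x : M) (l : List M) : unionCount G l ≤ unionCount G (x :: l) := by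
  classical
  rw [unionCount, unionCount, List.countP_cons]
  exact Nat.le_add_right _ _

theorem unionCount_cons_of_mem (hx : x ∈ ⨆ k, G k) :
    unionCount G (x :: l) = unionCount G l + 1 := by
  classical
  exact List.countP_cons_of_pos (by simpa using hx)

theorem unionCount_cons_of_notMem (hx : x ∉ ⨆ k, G k) :
    unionCount G (x :: l) = unionCount G l := by
  classical
  exact List.countP_cons_of_neg (by simpa using hx)

theorem unionCount_subdivide {a : M} (ha : a ∉ ⨆ k, G k) (l : List M) :
    unionCount G (subdivide a l) = unionCount G l := by
  induction l generalizing a with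
  | nil => rfl
  | cons x l ih =>
    have hl : unionCount G (a :: subdivide a⁻¹ l) = unionCount G l := by
      rw [unionCount_cons_of_notMem ha, ih (mt inv_mem_iff.1 ha)]
    rw [subdivide]
    by_cases hx : x ∈ ⨆ k, G k
    · rw [unionCount_cons_of_mem hx, unionCount_cons_of_mem hx, hl]
    · rw [unionCount_cons_of_notMem hx, unionCount_cons_of_notMem hx, hl]

theorem exists_eq_append_of_mem_tail {α : Type*} {l : List α} {c : α} (hc : c ∈ l.tail) :
    ∃ l₁ x l₂, l = l₁ ++ x :: c :: l₂ := by
  cases l with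
  | nil => cases hc
  | cons y l =>
    obtain ⟨s, t, rfl⟩ := List.append_of_mem (show c ∈ l from hc)
    obtain rfl | ⟨s', x, rfl⟩ := s.eq_nil_or_concat
    · exact ⟨[], y, t, rfl⟩
    · exact ⟨y :: s', x, t, by simp⟩

theorem exists_reduced_wordVertex (l : List M) : ∃ l', wordVertex G n false l' =
    wordVertex G n false l ∧ (∀ x ∈ l'.tail, x ∉ G n) ∧ unionCount G l' ≤ unionCount G l := by
  induction hN : l.length using Nat.strong_induction_on generalizing l with
  | _ N ih =>
  by_cases hl : ∀ x ∈ l.tail, x ∉ G n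
  · exact ⟨l, rfl, hl, le_rfl⟩
  push Not at hl
  obtain ⟨c, hcl, hc⟩ := hl
  obtain ⟨l₁, x, l₂, rfl⟩ := exists_eq_append_of_mem_tail hcl
  obtain ⟨l', hl', hred, hcount⟩ :=
    ih _ (by simp [← hN]) (l₁ ++ l₂.modifyHead (x * c * ·)) rfl
  refine ⟨l', hl'.trans (wordVertex_merge hc l₁ l₂ x false).symm, hred, hcount.trans ?_⟩
  rw [unionCount_append, unionCount_append]
  refine Nat.add_le_add_left (le_trans ?_ (unionCount_le_cons _ _)) _
  rw [unionCount_cons_of_mem (Subgroup.mem_iSup_of_mem n hc)]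
  cases l₂ with
  | nil => exact Nat.zero_le _
  | cons z l₂ =>
    exact (unionCount_cons_le _ _).trans (Nat.add_le_add_right (unionCount_le_cons _ _) 1)

variable (hG : Monotone G) (h1 : CondP1 G a)

theorem foldMap_wordVertex (l : List M) :
    foldMap G a hG h1 n (wordVertex G n false l) =
        wordVertex G (n + 1) false (subdivide (a (n + 1)) l) ∧
      foldMap G a hG h1 n (wordVertex G n true l) = inM' G (n + 1) (a (n + 1)) •
        wordVertex G (n + 1) false (subdivide (a (n + 1))⁻¹ l) := by
  induction l with
  | nil =>
    constructor
    · rw [wordVertex, foldMap_vertex_false, map_one]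
      rfl
    · rw [wordVertex, foldMap_vertex_true, map_one, one_mul, subdivide, wordVertex, smul_vertex,
        mul_one]
  | cons x l ih =>
    constructor
    · rw [wordVertex, foldMap_smul, Bool.not_false, ih.2, factor_false, phi_inM]
      rfl
    · rw [wordVertex, foldMap_smul, Bool.not_true, ih.1, factor_true, phi_inM', mul_smul, mul_smul,
        ← map_inv, subdivide, inv_inv]
      rfl

theorem exists_seqMap_wordVertex (ha : ∀ i, a (i + 1) ∉ ⨆ k, G k) {j : ℕ} (h : n ≤ j)
    (l : List M) : ∃ l', seqMap (foldMap G a hG h1) h (wordVertex G n false l) =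
      wordVertex G j false l' ∧ (l'.length / 2 ^ j : ℝ) = l.length / 2 ^ n ∧
      unionCount G l' = unionCount G l ∧ ∀ x ∈ ⨆ k, G k, (x ∈ l'.tail ↔ x ∈ l.tail) := by
  induction j, h using Nat.le_induction with
  | base => exact ⟨l, seqMap_self _ _, rfl, rfl, fun _ _ => .rfl⟩
  | succ j h ih =>
    obtain ⟨l', hl', hlen, hcount, htail⟩ := ih
    refine ⟨subdivide (a (j + 1)) l', ?_, ?_, ?_, fun x hx => ?_⟩
    · rw [seqMap_succ _ h, hl', (foldMap_wordVertex hG h1 l').1]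
    · rw [length_subdivide, ← hlen, pow_succ', Nat.cast_mul, Nat.cast_two,
        mul_div_mul_left _ _ two_ne_zero]
    · rw [unionCount_subdivide (ha j), hcount]
    · rw [mem_tail_subdivide_iff (ha j) hx, htail x hx]

theorem permIso_wordVertex (ha : ∀ i, a (i + 1) ∉ ⨆ k, G k) (hl : ∀ x ∈ l.tail, x ∉ ⨆ k, G k) :
    PermIso (foldMap G a hG h1) (vertex G n false 1) (wordVertex G n false l) := by
  have notMem_of_notMem_iSup {x : M} (hx : x ∉ ⨆ k, G k) (j : ℕ) : x ∉ G j :=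
    fun h => hx (Subgroup.mem_iSup_of_mem j h)
  intro j hj
  obtain ⟨l', hl', hlen, -, htail⟩ := exists_seqMap_wordVertex hG h1 ha hj l
  have hgood : ∀ x ∈ l'.tail, x ∉ ⨆ k, G k := fun x hx hmem => hl x ((htail x hmem).1 hx) hmem
  rw [hl', seqMap_vertex_false, map_one,
    dist_wordVertex false fun x hx => notMem_of_notMem_iSup (hgood x hx) j,
    dist_wordVertex false fun x hx => notMem_of_notMem_iSup (hl x hx) n, hlen]

theorem exists_foldMap_wordVertex_unionCount_lt (ha : a (n + 1) ∉ ⨆ k, G k)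
    (h4 : EscapesUnion G a) (hcl : c ∈ l.tail) (hc : c ∈ G (n + 1)) (hc' : c ∉ G n) :
    ∃ l', foldMap G a hG h1 n (wordVertex G n false l) = wordVertex G (n + 1) false l' ∧
      unionCount G l' < unionCount G l := by
  obtain ⟨l₁, x, l₂, rfl⟩ := exists_eq_append_of_mem_tail hcl
  obtain ⟨b, hb, happ⟩ := exists_subdivide_append (a (n + 1)) l₁
  have hgood : b * c * b⁻¹ ∉ ⨆ k, G k := by
    rcases hb with rfl | rfl
    · exact (h4 n c hc hc').1
    · rw [inv_inv]
      exact (h4 n c hc hc').2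
  have hb' : b ∉ ⨆ k, G k := by
    rcases hb with rfl | rfl
    · exact ha
    · exact mt inv_mem_iff.1 ha
  have hsub : subdivide (a (n + 1)) (l₁ ++ x :: c :: l₂) =
      (subdivide (a (n + 1)) l₁ ++ [x]) ++ b :: c :: b⁻¹ :: subdivide b l₂ := by
    rw [happ, subdivide, subdivide, inv_inv, List.append_assoc]
    rfl
  refine ⟨_, (foldMap_wordVertex hG h1 _).1.trans (hsub ▸ wordVertex_merge hc _ _ _ _), ?_⟩
  rw [List.modifyHead_cons, unionCount_append, unionCount_append, unionCount_subdivide ha,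
    unionCount_cons_of_notMem hgood, unionCount_subdivide hb', unionCount_append,
    ← List.singleton_append (l := c :: l₂), unionCount_append,
    unionCount_cons_of_mem (Subgroup.mem_iSup_of_mem _ hc)]
  omega

/-- A letter `c` in some `G (k + 1) \ G k` survives until the `k`-th tree; folding once more turns
it into the letter `a c a⁻¹` or `a⁻¹ c a`, which is in none of the subgroups. Hence only finitely
many foldings shorten the path. -/
theorem eventuallyStable_wordVertex (ha : ∀ i, a (i + 1) ∉ ⨆ k, G k) (h4 : EscapesUnion G a)
    (l : List M) :
    EventuallyStable (foldMap G a hG h1) (vertex G n false 1) (wordVertex G n false l) := by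
  induction hN : unionCount G l using Nat.strong_induction_on generalizing n l with
  | _ N ih =>
  obtain ⟨l', hl', hred, hcount⟩ := exists_reduced_wordVertex (G := G) (n := n) l
  rw [← hl']
  by_cases hgood : ∀ x ∈ l'.tail, x ∉ ⨆ k, G k
  · exact (permIso_wordVertex hG h1 ha hgood).eventuallyStable
  push Not at hgood
  obtain ⟨c, hcl, hc⟩ := hgood
  obtain ⟨k, hnk, hck, hck'⟩ := exists_mem_succ_notMem hG hc (hred c hcl)
  obtain ⟨l'', hl'', -, hcount', htail⟩ := exists_seqMap_wordVertex hG h1 ha hnk l'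
  obtain ⟨w, hw, hlt⟩ := exists_foldMap_wordVertex_unionCount_lt hG h1 (ha k) h4
    ((htail c hc).2 hcl) hck hck'
  refine .of_seqMap hnk (.of_map ?_)
  rw [hl'', hw, seqMap_vertex_false, map_one, foldMap_vertex_false, map_one]
  exact ih _ (by omega) w rfl

end FoldWord

/-! ### Stability of distances -/

section Stability

variable {M : Type*} [Group M] {G : ℕ → Subgroup M} {a : ℕ → M} (hG : Monotone G)
  (h1 : CondP1 G a) {n : ℕ} {x y : BSTree G n}

theorem PermIso.smul (h : PermIso (foldMap G a hG h1) x y) (g : Amalgam G n) :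
    PermIso (foldMap G a hG h1) (g • x) (g • y) := by
  intro j hj
  rw [seqMap_smul, seqMap_smul, BSTree.dist_smul, BSTree.dist_smul, h j hj]

theorem EventuallyStable.smul (h : EventuallyStable (foldMap G a hG h1) x y) (g : Amalgam G n) :
    EventuallyStable (foldMap G a hG h1) (g • x) (g • y) := by
  obtain ⟨k, hk, h⟩ := h
  refine ⟨k, hk, ?_⟩
  rw [seqMap_smul, seqMap_smul]
  exact h.smul hG h1 _

theorem permIso_vertex (ha : ∀ i, a (i + 1) ∉ ⨆ k, G k) (g : Amalgam G n) :
    PermIso (foldMap G a hG h1) (vertex G n false g) (vertex G n true g) := by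
  have hl : ∀ x ∈ [1, a (n + 1)].tail, x ∉ ⨆ k, G k := List.forall_mem_singleton.2 (ha n)
  have image_false : foldMap G a hG h1 n (vertex G n false g) =
      phi G a hG h1 n g • vertex G (n + 1) false 1 := by
    rw [foldMap_vertex_false, smul_vertex, mul_one]
  have image_true : foldMap G a hG h1 n (vertex G n true g) =
      phi G a hG h1 n g • wordVertex G (n + 1) false [1, a (n + 1)] := by
    simp only [foldMap_vertex_true, wordVertex, map_one, one_smul, smul_vertex, mul_one,
      Bool.not_false, Bool.not_true, factor_true]
  refine PermIso.of_map ?_ ?_ <;> rw [image_false, image_true]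
  · exact (permIso_wordVertex hG h1 ha hl).smul hG h1 _
  · rw [BSTree.dist_smul, dist_vertex_false_true,
      dist_wordVertex false fun x hx hmem => hl x hx (Subgroup.mem_iSup_of_mem _ hmem), pow_succ]
    simp [field]

theorem metricBtw_pt (e : Amalgam G n ⧸ edgeGroup G n) {s u v : unitInterval} (h : s ≤ u)
    (h' : u ≤ v) : MetricBtw (Realization.pt _ _ e s : BSTree G n) (Realization.pt _ _ e u)
      (Realization.pt _ _ e v) := by
  have h : (s : ℝ) ≤ u := h
  have h' : (u : ℝ) ≤ v := h'
  unfold MetricBtw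
  rw [BSTree.dist_pt, BSTree.dist_pt, BSTree.dist_pt, abs_of_nonpos (by linarith),
    abs_of_nonpos (by linarith), abs_of_nonpos (by linarith)]
  ring

theorem metricBtw_vertex_pt (g : Amalgam G n) (s : unitInterval) : MetricBtw (vertex G n false g)
    (Realization.pt _ _ (g : Amalgam G n ⧸ edgeGroup G n) s) (vertex G n true g) :=
  metricBtw_pt _ unitInterval.nonneg' unitInterval.le_one'

theorem OnEdge.permIso (ha : ∀ i, a (i + 1) ∉ ⨆ k, G k) (h : OnEdge x y) :
    PermIso (foldMap G a hG h1) x y := by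
  have hf := foldMap_lipschitz G a hG h1
  obtain ⟨e, s, u, rfl, rfl⟩ := h
  obtain ⟨g, rfl⟩ := QuotientGroup.mk_surjective e
  wlog hsu : s ≤ u generalizing s u
  · exact (this u s (le_of_not_ge hsu)).symm
  have hu := ((permIso_vertex hG h1 ha g).metricBtw hf (metricBtw_vertex_pt g u)).1
  exact (hu.metricBtw hf (metricBtw_pt _ unitInterval.nonneg' hsu)).2.1

theorem isTreeMorphism_foldMap (ha : ∀ i, a (i + 1) ∉ ⨆ k, G k) (n : ℕ) :
    IsTreeMorphism (foldMap G a hG h1 n) := by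
  refine isTreeMorphism_of_chain BSTree.fourPoint isPiece_onEdge BSTree.chain _ fun x y h => ?_
  have hdist := h.permIso hG h1 ha (n + 1) (Nat.le_succ n)
  rwa [← seqMap_succ_left _ le_rfl, ← seqMap_succ_left _ le_rfl, seqMap_self, seqMap_self] at hdist

theorem eventuallyStable_vertex (ha : ∀ i, a (i + 1) ∉ ⨆ k, G k) (h4 : EscapesUnion G a)
    (b b' : Bool) (g g' : Amalgam G n) :
    EventuallyStable (foldMap G a hG h1) (vertex G n b g) (vertex G n b' g') := by
  have of_false (n : ℕ) (g g' : Amalgam G n) (b' : Bool) :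
      EventuallyStable (foldMap G a hG h1) (vertex G n false g) (vertex G n b' g') := by
    obtain ⟨l, hl⟩ := exists_wordVertex_eq_vertex b' (g⁻¹ * g')
    have h := (eventuallyStable_wordVertex hG h1 ha h4 l).smul hG h1 g
    rwa [hl, smul_vertex, smul_vertex, mul_one, mul_inv_cancel_left] at h
  cases b
  · exact of_false n g g' b'
  · refine .of_map ?_
    rw [foldMap_vertex_true]
    cases b'
    · rw [foldMap_vertex_false]
      exact of_false _ _ _ _
    · rw [foldMap_vertex_true]
      exact of_false _ _ _ _

theorem eventuallyStable (ha : ∀ i, a (i + 1) ∉ ⨆ k, G k) (h4 : EscapesUnion G a)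
    (x y : BSTree G n) : EventuallyStable (foldMap G a hG h1) x y := by
  have of_vertex {z : BSTree G n}
      (hz : ∀ b g, EventuallyStable (foldMap G a hG h1) z (vertex G n b g)) (y : BSTree G n) :
      EventuallyStable (foldMap G a hG h1) z y := by
    obtain ⟨e, u, rfl⟩ := Realization.exists_eq_pt y
    obtain ⟨g, rfl⟩ := QuotientGroup.mk_surjective e
    exact .of_metricBtw (fun _ => BSTree.fourPoint) (foldMap_lipschitz G a hG h1)
      (permIso_vertex hG h1 ha g) (metricBtw_vertex_pt g u) (hz _ _) (hz _ _)
  exact of_vertex (fun b g => (of_vertex (fun b' g' =>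
    eventuallyStable_vertex hG h1 ha h4 b b' g g') x).symm) y

theorem convergesStrongly_foldMap (ha : ∀ i, a (i + 1) ∉ ⨆ k, G k) (h4 : EscapesUnion G a) :
    ConvergesStrongly (foldMap G a hG h1) :=
  convergesStrongly_of_chain (fun _ => BSTree.fourPoint) (foldMap_lipschitz G a hG h1)
    (fun _ => eventuallyStable hG h1 ha h4)
    fun _ x y => (BSTree.chain x y).mono fun _ _ h => h.permIso hG h1 ha

end Stability

/-! ### Stabilizers of edges -/

section EdgeStabilizer

variable {M : Type*} [Group M] {G : ℕ → Subgroup M} {a : ℕ → M} (hG : Monotone G)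
  (h1 : CondP1 G a) {n m j : ℕ}

theorem phiLE_inM'_injective (h : m ≤ j) :
    Function.Injective fun x => phiLE G a hG h1 m j h (inM' G m x) := by
  intro x y hxy
  dsimp only at hxy
  rcases h.eq_or_lt with rfl | h
  · rw [phiLE_self, phiLE_self] at hxy
    exact inM'_injective G m hxy
  · have h : m + 1 ≤ j := h
    rw [← phiLE_succ_left hG h1 h, ← phiLE_succ_left hG h1 h, phi_inM', phi_inM'] at hxy
    simp only [map_mul, map_inv, mul_left_inj, mul_right_inj, phiLE_inM] at hxy
    exact inM_injective G j hxy

theorem eq_conj_of_phiLE_eq (h : m ≤ j) {b c₁ c₂ : M} (hc₁ : c₁ ∈ G m) (hc₂ : c₂ ∈ G m)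
    {g : Amalgam G m} (heq : phiLE G a hG h1 m j h (g * inM G m c₁ * g⁻¹) =
      phiLE G a hG h1 m j h (g * inM' G m b * inM G m c₂ * (g * inM' G m b)⁻¹)) :
    c₁ = b * c₂ * b⁻¹ := by
  refine phiLE_inM'_injective hG h1 h ?_
  rw [inM_eq_inM' G m hc₁, inM_eq_inM' G m hc₂] at heq
  simp only [map_mul, map_inv, mul_inv_rev, mul_assoc, mul_right_inj] at heq
  simp only [← mul_assoc, mul_left_inj] at heq
  simpa only [map_mul, map_inv] using heq

theorem exists_eq_conj_of_smul_vertex_eq {g h : Amalgam G n}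
    (hf : h • vertex G n false g = vertex G n false g)
    (ht : h • vertex G n true g = vertex G n true g) : ∃ c ∈ G n, h = g * inM G n c * g⁻¹ := by
  rw [smul_vertex, eq_comm, vertex_eq_vertex_iff] at hf ht
  obtain ⟨c, hc, hcg⟩ := range_inf_range_le G n ⟨hf, ht⟩
  exact ⟨c, hc, by rw [hcg]; group⟩

theorem MetricBtw.smul_eq {x y z : BSTree G n} (hb : MetricBtw x y z) {h : Amalgam G n}
    (hx : h • x = x) (hz : h • z = z) : h • y = y := by
  have hb' := hb.smul h
  rw [hx, hz] at hb'
  refine BSTree.fourPoint.eq_of_metricBtw hb' hb ?_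
  conv_lhs => rw [← hx]
  exact BSTree.dist_smul h x y

theorem foldMap_midpoint (g : Amalgam G n) :
    foldMap G a hG h1 n (Realization.pt _ _ (g : Amalgam G n ⧸ edgeGroup G n)
      ⟨1 / 2, by norm_num, by norm_num⟩) = vertex G (n + 1) true (phi G a hG h1 n g) := by
  rw [foldMap_pt, foldEdge, if_pos le_rfl]
  simp only [mul_one_div_cancel (two_ne_zero (α := ℝ)), Set.projIcc_right]
  rfl

/-- An element fixing the image of an edge also fixes the image of its midpoint, hence the images of
both halves. So, at the next level, it comes from `c₁ ∈ G (m + 1)` and from `c₂ ∈ G (m + 1)` with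
`c₁ = a c₂ a⁻¹`, which forces `c₁ ∈ G m`. -/
theorem exists_eq_phiLE_conj_of_smul_seqMap_eq (ha : ∀ i, a (i + 1) ∉ ⨆ k, G k)
    (h4 : EscapesUnion G a) (hmj : m ≤ j) (g : Amalgam G m) (h : Amalgam G j)
    (hf : h • seqMap (foldMap G a hG h1) hmj (vertex G m false g) =
      seqMap (foldMap G a hG h1) hmj (vertex G m false g))
    (ht : h • seqMap (foldMap G a hG h1) hmj (vertex G m true g) =
      seqMap (foldMap G a hG h1) hmj (vertex G m true g)) :
    ∃ c ∈ G m, h = phiLE G a hG h1 m j hmj (g * inM G m c * g⁻¹) := by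
  induction hq : j - m generalizing m with
  | zero =>
    obtain rfl : m = j := by omega
    rw [seqMap_self] at hf ht
    simpa only [phiLE_self] using exists_eq_conj_of_smul_vertex_eq hf ht
  | succ q ih =>
    have hmj' : m + 1 ≤ j := by omega
    have hmid := ((permIso_vertex hG h1 ha g).metricBtw (foldMap_lipschitz G a hG h1)
      (metricBtw_vertex_pt g ⟨1 / 2, by norm_num, by norm_num⟩)).2.2 j hmj
    have hmid := hmid.smul_eq hf ht
    rw [← seqMap_succ_left _ hmj', foldMap_midpoint] at hmid
    rw [← seqMap_succ_left _ hmj', foldMap_vertex_false] at hf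
    rw [← seqMap_succ_left _ hmj', foldMap_vertex_true] at ht
    obtain ⟨c₁, hc₁, eq₁⟩ := ih hmj' _ hf hmid (by omega)
    have hmid' : vertex G (m + 1) true (phi G a hG h1 m g * inM' G (m + 1) (a (m + 1))) =
        vertex G (m + 1) true (phi G a hG h1 m g) := vertex_mul_factor true _ _
    obtain ⟨c₂, hc₂, eq₂⟩ := ih hmj' _ ht (by rwa [hmid']) (by omega)
    have hconj : c₁ = a (m + 1) * c₂ * (a (m + 1))⁻¹ :=
      eq_conj_of_phiLE_eq hG h1 hmj' hc₁ hc₂ (eq₁.symm.trans eq₂)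
    have hc₁' : c₁ ∈ G m := by
      by_contra hcm
      refine (h4 m c₁ hc₁ hcm).2 (Subgroup.mem_iSup_of_mem (m + 1) ?_)
      rw [hconj]
      simpa only [mul_assoc, inv_mul_cancel, mul_one, inv_mul_cancel_left] using hc₂
    refine ⟨c₁, hc₁', ?_⟩
    rw [eq₁, ← phiLE_succ_left hG h1 hmj']
    simp only [map_mul, map_inv, phi_inM]

end EdgeStabilizer

/-! ### Edges inside segments -/

section EdgeInSegment

variable {M : Type*} [Group M] {G : ℕ → Subgroup M} {n : ℕ} {x y : BSTree G n}

theorem exists_edge_metricBtw_wordVertex {u v : M} {l : List M} (hl : ∀ z ∈ v :: l, z ∉ G n) :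
    ∃ g, MetricBtw (vertex G n false 1) (vertex G n true g) (wordVertex G n false (u :: v :: l)) ∧
      MetricBtw (vertex G n true g) (vertex G n false g) (wordVertex G n false (u :: v :: l)) ∧
      dist (vertex G n false 1) (vertex G n true g) = 1 / 2 ^ n ∧
      dist (vertex G n false g) (wordVertex G n false (u :: v :: l)) = l.length / 2 ^ n := by
  obtain ⟨-, hl'⟩ := List.forall_mem_cons.1 hl
  have hword : wordVertex G n false (u :: v :: l) =
      (factor G n false u * factor G n true v) • wordVertex G n false l := by
    rw [wordVertex, wordVertex, ← mul_smul, Bool.not_not, Bool.not_false]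
  have htrue := (metricBtw_wordVertex false hl).smul (factor G n false u)
  have hturn : vertex G n true (factor G n false u * factor G n true v) =
      factor G n false u • vertex G n true 1 := by
    rw [vertex_mul_factor, smul_vertex, mul_one]
  rw [factor_smul_vertex_one, Bool.not_false, ← hturn] at htrue
  have hfalse := (metricBtw_wordVertex true hl').smul (factor G n false u * factor G n true v)
  rw [Bool.not_true, ← hword, smul_vertex, smul_vertex, mul_one] at hfalse
  refine ⟨factor G n false u * factor G n true v, htrue, hfalse, ?_, ?_⟩
  · rw [hturn, ← factor_smul_vertex_one false u, BSTree.dist_smul, dist_vertex_false_true]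
  · have hstart : vertex G n false (factor G n false u * factor G n true v) =
        (factor G n false u * factor G n true v) • vertex G n false 1 := by
      rw [smul_vertex, mul_one]
    rw [hword, hstart, BSTree.dist_smul,
      dist_wordVertex false fun z hz => hl' z (List.mem_of_mem_tail hz)]

theorem exists_edge_metricBtw_vertex {k k' : Amalgam G n}
    (h : 3 / 2 ^ n ≤ dist (vertex G n false k) (vertex G n false k')) :
    ∃ g, MetricBtw (vertex G n false k) (vertex G n true g) (vertex G n false k') ∧
      MetricBtw (vertex G n true g) (vertex G n false g) (vertex G n false k') ∧
      1 / 2 ^ n ≤ dist (vertex G n false k) (vertex G n true g) ∧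
      1 / 2 ^ n ≤ dist (vertex G n false g) (vertex G n false k') := by
  obtain ⟨l, hl⟩ := exists_wordVertex_eq_vertex false (k⁻¹ * k')
  obtain ⟨l, hl', hred, -⟩ := exists_reduced_wordVertex (n := n) l
  have hstart : k • vertex G n false 1 = vertex G n false k := by rw [smul_vertex, mul_one]
  have hend : k • wordVertex G n false l = vertex G n false k' := by
    rw [hl', hl, smul_vertex, mul_inv_cancel_left]
  rw [← hend, ← hstart, BSTree.dist_smul, dist_wordVertex false hred,
    div_le_div_iff_of_pos_right (by positivity)] at h
  obtain ⟨u, v, l, rfl⟩ : ∃ u v l', l = u :: v :: l' := by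
    match l, h with
    | u :: v :: l', _ => exact ⟨u, v, l', rfl⟩
    | [_], h => norm_num at h
    | [], h => norm_num at h
  have hlen : (1 : ℝ) ≤ l.length := by
    rw [List.length_cons, List.length_cons] at h
    push_cast at h
    linarith
  obtain ⟨g, htrue, hfalse, hdist_true, hdist_false⟩ :=
    exists_edge_metricBtw_wordVertex (u := u) hred
  refine ⟨k * g, ?_, ?_, ?_, ?_⟩ <;> rw [← smul_vertex]
  · rw [← hstart, ← hend]
    exact htrue.smul k
  · rw [← smul_vertex, ← hend]
    exact hfalse.smul k
  · rw [← hstart, BSTree.dist_smul, hdist_true]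
  · rw [← hend, BSTree.dist_smul, hdist_false]
    gcongr

theorem exists_edge_metricBtw (h : 5 / 2 ^ n ≤ dist x y) :
    ∃ g, MetricBtw x (vertex G n false g) y ∧ MetricBtw x (vertex G n true g) y := by
  have exists_near (z : BSTree G n) : ∃ k, dist (vertex G n false k) z ≤ 1 / 2 ^ n := by
    obtain ⟨e, s, rfl⟩ := Realization.exists_eq_pt z
    obtain ⟨k, rfl⟩ := QuotientGroup.mk_surjective e
    have hb : _ + _ = dist _ _ := metricBtw_vertex_pt k s
    rw [dist_vertex_false_true] at hb
    exact ⟨k, hb ▸ le_add_of_nonneg_right dist_nonneg⟩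
  obtain ⟨k, hk⟩ := exists_near x
  obtain ⟨k', hk'⟩ := exists_near y
  have hkk' : 3 / 2 ^ n ≤ dist (vertex G n false k) (vertex G n false k') := by
    have htri := dist_triangle4_right x y (vertex G n false k) (vertex G n false k')
    rw [dist_comm x (vertex G n false k), dist_comm y (vertex G n false k')] at htri
    have hfive : (5 / 2 ^ n : ℝ) = 1 / 2 ^ n + 1 / 2 ^ n + 3 / 2 ^ n := by ring
    linarith
  obtain ⟨g, htrue, hfalse, hk_true, hfalse_k'⟩ := exists_edge_metricBtw_vertex hkk'
  have hx_true := BSTree.fourPoint.metricBtw_of_dist_le htrue (hk.trans hk_true)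
  have hx_false := (hx_true.symm.trans_left hfalse.symm).symm
  have hbtw := (hx_true.symm.trans_right hfalse.symm).symm
  rw [dist_comm] at hfalse_k'
  have hy_false := BSTree.fourPoint.metricBtw_of_dist_le hx_false.symm (hk'.trans hfalse_k')
  exact ⟨g, hy_false.symm, hy_false.symm.trans_left hbtw⟩

end EdgeInSegment

/-! ### The limit group and its action -/

section LimitAction

variable {M : Type*} [Group M] {G : ℕ → Subgroup M} {a : ℕ → M} (hG : Monotone G)
  (h1 : CondP1 G a)

/-- The natural homomorphism from the `m`-th group of the sequence to the limit group. -/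
noncomputable def psiHom (m : ℕ) : Amalgam G m →* LimitGroup G a hG h1 where
  toFun g := Quotient.mk _ ⟨m, g⟩
  map_one' := (DirectLimit.one_def m).symm
  map_mul' x y := (DirectLimit.mul_def m x y).symm

theorem psiHom_phiLE {l j : ℕ} (h : l ≤ j) (g : Amalgam G l) :
    psiHom hG h1 j (phiLE G a hG h1 l j h g) = psiHom hG h1 l g :=
  (DirectLimit.eq_of_le (f := fun l j h => phiLE G a hG h1 l j h) ⟨l, g⟩ j h).symm

theorem exists_phiLE_eq_one {m : ℕ} {g : Amalgam G m} (h : psiHom hG h1 m g = 1) :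
    ∃ (k : ℕ) (hk : m ≤ k), phiLE G a hG h1 m k hk g = 1 :=
  (DirectLimit.exists_eq_one (f := fun l j h => phiLE G a hG h1 l j h) ⟨m, g⟩).1 h

theorem psiHom_surjective (h2 : CondP2 G a) : Function.Surjective (psiHom hG h1 0) := by
  intro x
  obtain ⟨⟨m, g⟩, rfl⟩ := Quotient.exists_rep x
  obtain ⟨g', rfl⟩ : ∃ g', phiLE G a hG h1 0 m (Nat.zero_le m) g' = g :=
    seqMap_surjective (phi_surjective hG h1 h2) (Nat.zero_le m) g
  exact ⟨g', (psiHom_phiLE hG h1 _ g').symm⟩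

theorem psiHom_inM_injective (m : ℕ) :
    Function.Injective ((psiHom hG h1 m).comp (inM G m)) := by
  refine (injective_iff_map_eq_one _).2 fun c hc => ?_
  obtain ⟨k, hk, hone⟩ := exists_phiLE_eq_one hG h1 hc
  rw [phiLE_inM, ← map_one (inM G k)] at hone
  exact inM_injective G k hone

theorem theta_surjective : Function.Surjective (theta G a hG h1) :=
  toLimit_surjective (foldMap_lipschitz G a hG h1)

theorem dist_theta_smul (g : Amalgam G 0) (x y : BSTree G 0) :
    dist (theta G a hG h1 (g • x)) (theta G a hG h1 (g • y)) =
      dist (theta G a hG h1 x) (theta G a hG h1 y) := by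
  unfold theta
  rw [dist_toLimit, dist_toLimit, limDist, limDist]
  simp only [seqMap_smul, BSTree.dist_smul]

/-- The transformation of the limit tree induced by an element of the first group, computed on an
arbitrarily chosen preimage under `theta`. -/
noncomputable def limitSMul (g : Amalgam G 0) (x : LimitTree G a hG h1) : LimitTree G a hG h1 :=
  theta G a hG h1 (g • Function.surjInv (theta_surjective hG h1) x)

theorem limitSMul_theta (g : Amalgam G 0) (x : BSTree G 0) :
    limitSMul hG h1 g (theta G a hG h1 x) = theta G a hG h1 (g • x) := by
  rw [← dist_eq_zero, limitSMul, dist_theta_smul, Function.surjInv_eq (theta_surjective hG h1),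
    dist_self]

/-- The isometric action of the first group of the sequence on the limit tree. -/
noncomputable def limitAction : Amalgam G 0 →* (LimitTree G a hG h1 ≃ᵢ LimitTree G a hG h1) where
  toFun g :=
    { toFun := limitSMul hG h1 g
      invFun := limitSMul hG h1 g⁻¹
      left_inv := (theta_surjective hG h1).forall.2 fun x => by
        rw [limitSMul_theta, limitSMul_theta, inv_smul_smul]
      right_inv := (theta_surjective hG h1).forall.2 fun x => by
        rw [limitSMul_theta, limitSMul_theta, smul_inv_smul]
      isometry_toFun := Isometry.of_dist_eq <| (theta_surjective hG h1).forall₂.2 fun x y => by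
        rw [limitSMul_theta, limitSMul_theta, dist_theta_smul] }
  map_one' := IsometryEquiv.ext <| (theta_surjective hG h1).forall.2 fun x =>
    (limitSMul_theta hG h1 1 x).trans (congrArg _ (one_smul _ x))
  map_mul' g g' := IsometryEquiv.ext <| (theta_surjective hG h1).forall.2 fun x => by
    change limitSMul hG h1 (g * g') _ = limitSMul hG h1 g (limitSMul hG h1 g' _)
    rw [limitSMul_theta, limitSMul_theta, limitSMul_theta, mul_smul]

theorem limitAction_theta (g : Amalgam G 0) (x : BSTree G 0) :
    limitAction hG h1 g (theta G a hG h1 x) = theta G a hG h1 (g • x) :=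
  limitSMul_theta hG h1 g x

theorem ker_psiHom_le : (psiHom hG h1 0).ker ≤ (limitAction hG h1).ker := by
  intro g hg
  obtain ⟨k, hk, hone⟩ := exists_phiLE_eq_one hG h1 (MonoidHom.mem_ker.1 hg)
  refine MonoidHom.mem_ker.2 (IsometryEquiv.ext <| (theta_surjective hG h1).forall.2 fun x => ?_)
  rw [limitAction_theta]
  refine toLimit_eq_of_seqMap_eq (foldMap_lipschitz G a hG h1) (k := k) ?_
  rw [seqMap_smul, hone, one_smul]

theorem exists_limitGroup_action (h2 : CondP2 G a) :
    ∃ ρ : LimitGroup G a hG h1 →* (LimitTree G a hG h1 ≃ᵢ LimitTree G a hG h1),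
      ∀ (g : Amalgam G 0) (x : BSTree G 0),
        ρ (psi G a hG h1 g) (theta G a hG h1 x) = theta G a hG h1 (g • x) := by
  refine ⟨(psiHom hG h1 0).liftOfSurjective (psiHom_surjective hG h1 h2)
    ⟨limitAction hG h1, ker_psiHom_le hG h1⟩, fun g x => ?_⟩
  rw [← limitAction_theta]
  exact DFunLike.congr_fun (MonoidHom.liftOfRightInverse_comp_apply _ _ _
    ⟨limitAction hG h1, ker_psiHom_le hG h1⟩ g) _

theorem isRTree_limitTree (h2 : CondP2 G a) (ha : ∀ i, a (i + 1) ∉ ⨆ k, G k)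
    (h4 : EscapesUnion G a) : IsRTree (LimitTree G a hG h1) := by
  have hf := foldMap_lipschitz G a hG h1
  refine (fourPoint_limitSpace hf fun _ => BSTree.fourPoint).isRTree ?_
  refine (theta_surjective hG h1).forall₂.2 fun x y => ?_
  obtain ⟨k, hk⟩ := eventuallyStable hG h1 ha h4 x y
  exact hk.exists_isSegment hf (foldMap_surjective hG h1 h2) (BSTree.isRTree.1 _ _)

/-- The translates of a vertex by the powers of `inM (a 1) * inM' (a 1)` are joined to it by paths
which are never folded, so that this element has unbounded orbits. -/
theorem exists_theta_smul_ne (ha : ∀ i, a (i + 1) ∉ ⨆ k, G k) (x : BSTree G 0) :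
    ∃ g : Amalgam G 0, theta G a hG h1 (g • x) ≠ theta G a hG h1 x := by
  by_contra! hfix
  set v := vertex G 0 false 1
  have dist_le (g : Amalgam G 0) : dist (theta G a hG h1 v) (theta G a hG h1 (g • v)) ≤
      2 * dist (theta G a hG h1 v) (theta G a hG h1 x) := by
    have htri := dist_triangle (theta G a hG h1 v) (theta G a hG h1 (g • x))
      (theta G a hG h1 (g • v))
    rw [dist_theta_smul, hfix, dist_comm (theta G a hG h1 x)] at htri
    linarith
  have dist_pow (k : ℕ) : dist (theta G a hG h1 v)
      (theta G a hG h1 ((inM G 0 (a 1) * inM' G 0 (a 1)) ^ k • v)) = 2 * k := by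
    have hl : ∀ z ∈ (List.replicate (2 * k) (a 1)).tail, z ∉ ⨆ k, G k := fun z hz =>
      List.eq_of_mem_replicate (List.mem_of_mem_tail hz) ▸ ha 0
    have hst := (permIso_wordVertex (n := 0) hG h1 ha hl).map_seqMap le_rfl
    have hdist := StableFrom.dist_toLimit (foldMap_lipschitz G a hG h1) ⟨le_rfl, hst⟩
    rw [seqMap_self, seqMap_self, dist_wordVertex false fun z hz hmem =>
      hl z hz (Subgroup.mem_iSup_of_mem 0 hmem), wordVertex_replicate] at hdist
    simpa [theta] using hdist
  obtain ⟨k, hk⟩ := exists_nat_gt (dist (theta G a hG h1 v) (theta G a hG h1 x))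
  linarith [dist_le ((inM G 0 (a 1) * inM' G 0 (a 1)) ^ k), dist_pow k]

end LimitAction

/-! ### Arc stabilizers -/

section ArcStabilizer

theorem exists_mulEquiv_of_le_range {A B : Type*} [Group A] [Group B] {κ : A →* B}
    (hκ : Function.Injective κ) {S : Subgroup B} (hS : S ≤ κ.range) :
    ∃ K : Subgroup A, Nonempty (S ≃* K) := by
  refine ⟨S.comap κ, ⟨((Subgroup.comap κ S).equivMapOfInjective κ hκ |>.trans ?_).symm⟩⟩
  exact MulEquiv.subgroupCongr (Subgroup.map_comap_eq_self hS)

variable {M : Type*} [Group M] {G : ℕ → Subgroup M} {a : ℕ → M} (hG : Monotone G)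
  (h1 : CondP1 G a)

theorem exists_edge_metricBtw_theta (h2 : CondP2 G a) (ha : ∀ i, a (i + 1) ∉ ⨆ k, G k)
    (h4 : EscapesUnion G a) {x y : LimitTree G a hG h1} (hxy : x ≠ y) :
    ∃ (m : ℕ) (g : Amalgam G m), ∀ b, ∃ u,
      seqMap (foldMap G a hG h1) (Nat.zero_le m) u = vertex G m b g ∧
        MetricBtw x (theta G a hG h1 u) y := by
  obtain ⟨p, rfl⟩ := theta_surjective hG h1 x
  obtain ⟨q, rfl⟩ := theta_surjective hG h1 y
  have hf := foldMap_lipschitz G a hG h1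
  obtain ⟨k, hk⟩ := eventuallyStable hG h1 ha h4 p q
  obtain ⟨N, hN⟩ := exists_pow_lt_of_lt_one (div_pos (dist_pos.2 hxy) (by norm_num : (0 : ℝ) < 5))
    (one_half_lt_one (α := ℝ))
  have hst := hk.mono (le_max_left k N)
  have hlong : 5 / 2 ^ max k N ≤ dist (theta G a hG h1 p) (theta G a hG h1 q) := by
    have hpow := pow_le_pow_of_le_one (by norm_num) (one_half_lt_one (α := ℝ)).le
      (le_max_right k N)
    rw [div_eq_mul_inv, ← inv_pow, ← one_div]
    linarith
  obtain ⟨g, hfalse, htrue⟩ := exists_edge_metricBtw (hlong.trans_eq (hst.dist_toLimit hf))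
  refine ⟨max k N, g, fun b => ?_⟩
  obtain ⟨u, hu⟩ := seqMap_surjective (foldMap_surjective hG h1 h2) (Nat.zero_le _)
    (vertex G (max k N) b g)
  refine ⟨u, hu, hst.metricBtw_toLimit hf ?_⟩
  rw [hu]
  cases b
  exacts [hfalse, htrue]

theorem exists_psiHom_eq_conj (ha : ∀ i, a (i + 1) ∉ ⨆ k, G k) (h4 : EscapesUnion G a) {m : ℕ}
    {g : Amalgam G m} {u v : BSTree G 0}
    (hu : seqMap (foldMap G a hG h1) (Nat.zero_le m) u = vertex G m false g)
    (hv : seqMap (foldMap G a hG h1) (Nat.zero_le m) v = vertex G m true g) {h : Amalgam G 0}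
    (hfu : theta G a hG h1 (h • u) = theta G a hG h1 u)
    (hfv : theta G a hG h1 (h • v) = theta G a hG h1 v) :
    ∃ c ∈ G m, psiHom hG h1 0 h = psiHom hG h1 m (g * inM G m c * g⁻¹) := by
  have hf := foldMap_lipschitz G a hG h1
  obtain ⟨k₁, hk₁⟩ := (eventuallyStable hG h1 ha h4 _ _).exists_seqMap_eq_of_toLimit_eq hf hfu
  obtain ⟨k₂, hk₂⟩ := (eventuallyStable hG h1 ha h4 _ _).exists_seqMap_eq_of_toLimit_eq hf hfv
  obtain ⟨j, hj⟩ := Filter.eventually_ge_atTop m |>.and (Filter.eventually_ge_atTop k₁) |>.and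
    (Filter.eventually_ge_atTop k₂) |>.exists
  obtain ⟨⟨hmj, hj₁⟩, hj₂⟩ := hj
  have hju := hk₁ j hj₁
  have hjv := hk₂ j hj₂
  rw [seqMap_smul, ← seqMap_trans _ (Nat.zero_le m) hmj, hu] at hju
  rw [seqMap_smul, ← seqMap_trans _ (Nat.zero_le m) hmj, hv] at hjv
  obtain ⟨c, hc, hconj⟩ := exists_eq_phiLE_conj_of_smul_seqMap_eq hG h1 ha h4 hmj g _ hju hjv
  exact ⟨c, hc, by rw [← psiHom_phiLE hG h1 (Nat.zero_le j), hconj, psiHom_phiLE]⟩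

theorem exists_mulEquiv_pointwiseStabilizer (h2 : CondP2 G a) (ha : ∀ i, a (i + 1) ∉ ⨆ k, G k)
    (h4 : EscapesUnion G a)
    {ρ : LimitGroup G a hG h1 →* (LimitTree G a hG h1 ≃ᵢ LimitTree G a hG h1)}
    (hρ : ∀ g x, ρ (psi G a hG h1 g) (theta G a hG h1 x) = theta G a hG h1 (g • x))
    {x y : LimitTree G a hG h1} {A : Set (LimitTree G a hG h1)} (hxy : x ≠ y)
    (hA : IsSegment A x y) :
    ∃ (m : ℕ) (K : Subgroup (G m)), Nonempty (pointwiseStabilizer ρ A ≃* K) := by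
  have hX := fourPoint_limitSpace (foldMap_lipschitz G a hG h1) fun _ => BSTree.fourPoint
  obtain ⟨m, g, hedge⟩ := exists_edge_metricBtw_theta hG h1 h2 ha h4 hxy
  obtain ⟨u, hu, hbu⟩ := hedge false
  obtain ⟨v, hv, hbv⟩ := hedge true
  let κ : G m →* LimitGroup G a hG h1 := (MulAut.conj (psiHom hG h1 m g)).toMonoidHom.comp
    (((psiHom hG h1 m).comp (inM G m)).comp (G m).subtype)
  have hκ : Function.Injective κ := (MulAut.conj _).injective.comp
    ((psiHom_inM_injective hG h1 m).comp (G m).subtype_injective)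
  refine ⟨m, exists_mulEquiv_of_le_range hκ fun q hq => ?_⟩
  obtain ⟨h, rfl⟩ := psiHom_surjective hG h1 h2 q
  rw [hX.isSegment_eq hA] at hq
  obtain ⟨c, hc, hconj⟩ := exists_psiHom_eq_conj hG h1 ha h4 hu hv
    ((hρ h u).symm.trans (hq _ hbu)) ((hρ h v).symm.trans (hq _ hbv))
  exact ⟨⟨c, hc⟩, by simp [κ, hconj]⟩

end ArcStabilizer

end StrongLimit

theorem mainTheorem3_general {M : Type*} [Group M] (G : ℕ → Subgroup M) (hG : StrictMono G)
    (a : ℕ → M) (h1 : CondP1 G a) (h2 : CondP2 G a) (h4 : EscapesUnion G a) :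
    (∀ n : ℕ, IsRTree (BSTree G n) ∧
      (∀ g : Amalgam G n, Isometry fun x : BSTree G n => g • x) ∧
      IsTreeMorphism (foldMap G a hG.monotone h1 n) ∧
      Function.Surjective (phi G a hG.monotone h1 n) ∧
      Function.Surjective (foldMap G a hG.monotone h1 n) ∧
      ∀ (g : Amalgam G n) (x : BSTree G n), foldMap G a hG.monotone h1 n (g • x) =
        phi G a hG.monotone h1 n g • foldMap G a hG.monotone h1 n x) ∧
    ConvergesStrongly (foldMap G a hG.monotone h1) ∧
    IsRTree (LimitTree G a hG.monotone h1) ∧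
    ∃ ρ : LimitGroup G a hG.monotone h1 →*
        (LimitTree G a hG.monotone h1 ≃ᵢ LimitTree G a hG.monotone h1),
      (∀ (g : Amalgam G 0) (x : BSTree G 0), ρ (psi G a hG.monotone h1 g)
        (theta G a hG.monotone h1 x) = theta G a hG.monotone h1 (g • x)) ∧
      (¬ ∃ x : LimitTree G a hG.monotone h1, ∀ g : LimitGroup G a hG.monotone h1, ρ g x = x) ∧
      ∀ (x y : LimitTree G a hG.monotone h1) (A : Set (LimitTree G a hG.monotone h1)),
        x ≠ y → IsSegment A x y →
          ∃ (m : ℕ) (K : Subgroup (G m)), Nonempty (pointwiseStabilizer ρ A ≃* K) := by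
  have ha := h4.notMem hG
  refine ⟨fun n => ⟨BSTree.isRTree, BSTree.isometry_smul,
    isTreeMorphism_foldMap hG.monotone h1 ha n,
    phi_surjective hG.monotone h1 h2 n, foldMap_surjective hG.monotone h1 h2 n,
    foldMap_smul hG.monotone h1 n⟩, convergesStrongly_foldMap hG.monotone h1 ha h4,
    isRTree_limitTree hG.monotone h1 h2 ha h4, ?_⟩
  obtain ⟨ρ, hρ⟩ := exists_limitGroup_action hG.monotone h1 h2
  refine ⟨ρ, hρ, fun ⟨x, hx⟩ => ?_, fun x y A hxy hA =>
    exists_mulEquiv_pointwiseStabilizer hG.monotone h1 h2 ha h4 hρ hxy hA⟩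
  obtain ⟨x, rfl⟩ := theta_surjective hG.monotone h1 x
  obtain ⟨g, hg⟩ := exists_theta_smul_ne hG.monotone h1 ha x
  exact hg ((hρ g x).symm.trans (hx _))

theorem mainTheorem3 {M : Type*} [Group M] [Group.FG M] (G : ℕ → Subgroup M) (hG : StrictMono G)
    (a : ℕ → M) (h1 : CondP1 G a) (h2 : CondP2 G a) (h4 : CondP4 G a) :
    -- `T n` is an `ℝ`-tree with an isometric action of `L n`, and the maps `T n → T (n + 1)` are
    -- surjective equivariant morphisms of `ℝ`-trees
    (∀ n : ℕ, IsRTree (BSTree G n) ∧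
      (∀ g : Amalgam G n, Isometry fun x : BSTree G n => g • x) ∧
      IsTreeMorphism (foldMap G a hG.monotone h1 n) ∧
      Function.Surjective (phi G a hG.monotone h1 n) ∧
      Function.Surjective (foldMap G a hG.monotone h1 n) ∧
      ∀ (g : Amalgam G n) (x : BSTree G n), foldMap G a hG.monotone h1 n (g • x) =
        phi G a hG.monotone h1 n g • foldMap G a hG.monotone h1 n x) ∧
    -- the sequence of trees converges strongly, and its limit is an `ℝ`-tree
    ConvergesStrongly (foldMap G a hG.monotone h1) ∧
    IsRTree (LimitTree G a hG.monotone h1) ∧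
    -- the actions of the `L n` induce an isometric action of the limit group on the limit tree
    ∃ ρ : LimitGroup G a hG.monotone h1 →*
        (LimitTree G a hG.monotone h1 ≃ᵢ LimitTree G a hG.monotone h1),
      (∀ (g : Amalgam G 0) (x : BSTree G 0), ρ (psi G a hG.monotone h1 g)
        (theta G a hG.monotone h1 x) = theta G a hG.monotone h1 (g • x)) ∧
      -- without a global fixed point
      (¬ ∃ x : LimitTree G a hG.monotone h1, ∀ g : LimitGroup G a hG.monotone h1, ρ g x = x) ∧
      -- and such that arc stabilizers are isomorphic to subgroups of the groups `G m`
      ∀ (x y : LimitTree G a hG.monotone h1) (A : Set (LimitTree G a hG.monotone h1)),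
        x ≠ y → IsSegment A x y →
          ∃ (m : ℕ) (K : Subgroup (G m)), Nonempty (pointwiseStabilizer ρ A ≃* K) :=
  mainTheorem3_general G hG a h1 h2 (h4.escapesUnion hG.monotone)
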